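/- Let $E$ be a holomorphic Hermitian vector bundle of rank $1$ over a bounded domain $\Omega\subset\mathbb C^m$, with curvature matrix $$\mathsf K(w)=\Big(-\frac{\partial^2\log\|s(w)\|^2}{\partial w_i\,\partial\bar w_j}\Big)_{i,j=1}^m,$$ where $s$ is any non-vanishing holomorphic local section of $E$ (the matrix does not depend on $s$). Suppose that $\mathsf K$ is a negative definite function on $\Omega$, that is, there is a matrix-valued function $\widetilde{\mathsf K}$ on $\Omega\times\Omega$, holomorphic in the first and anti-holomorphic in the second variable, with $\widetilde{\mathsf K}(w,w)=\mathsf K(w)$ for $w\in\Omega$, such that $-\widetilde{\mathsf K}$ is a positive definite kernel: for all $n$ and all $u_1,\dots,u_n\in\Omega$ the block matrix $\big(-\widetilde{\mathsf K}(u_i,u_j)\big)_{i,j=1}^n$ is positive semidefinite. Then every point $w_0\in\Omega$ has a connected open neighbourhood $\Omega_0\subseteq\Omega$ for which there are a separable complex Hilbert space $\mathcal H$ and a nowhere vanishing holomorphic map $\gamma:\Omega_0\to\mathcal H$ such that: 1. the restriction $E|_{\Omega_0}$ is isomorphic, as a holomorphic Hermitian bundle, to the bundle $E_\gamma=\{(w,x)\in\Omega_0\times\mathcal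 H: x\in\mathbb C\,\gamma(w)\}$, a holomorphic subbundle of the trivial bundle with the metric of $\mathcal H$; this is the pullback of the tautological bundle over the Grassmannian $\mathcal Gr(1,\mathcal H)$ of lines in $\mathcal H$ by the holomorphic map $\Omega_0\to\mathcal Gr(1,\mathcal H)$, $w\mapsto\mathbb C\,\gamma(w)$; 2. the kernel $K(z,w)=\langle\gamma(z),\gamma(w)\rangle$ on $\Omega_0\times\Omega_0$ (the inner product being linear in the first variable) is infinitely divisible: $K$ is a positive definite kernel and has a continuous logarithm $\log K$ on $\Omega_0\times\Omega_0$ that is real on the diagonal, and $K^t=\exp(t\log K)$ is a positive definite kernel for every real $t>0$ (all the matrices $\big(K^t(u_i,u_j)\big)_{i,j}$ are positive semidefinite). -/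

import Mathlib

open Bundle Manifold TopologicalSpace
open scoped ContDiff ComplexOrder

noncomputable section

/-! ### Hermitian bundles -/

/-- A Hermitian structure on a holomorphic vector bundle `E` over an open subset `Ω` of `ℂ^m`: each
fibre carries a Hermitian inner product (the instances), and the inner product depends smoothly
(`C^∞` in the real sense) on the base point, that is, in every holomorphic local trivialization
of the bundle its coefficients are smooth functions. -/
class IsHermitianBundle {m : ℕ} {Ω : Opens (Fin m → ℂ)}
    (F : Type*) [NormedAddCommGroup F] [NormedSpace ℂ F]
    (E : Ω → Type*) [∀ w, NormedAddCommGroup (E w)] [∀ w, InnerProductSpace ℂ (E w)]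
    [TopologicalSpace (TotalSpace F E)] [FiberBundle F E] [VectorBundle ℂ F E] : Prop where
  smooth_inner : ∀ (e : Trivialization F (π F E)) [MemTrivializationAtlas e] (u v : F),
    ContMDiffOn 𝓘(ℝ, Fin m → ℂ) 𝓘(ℝ, ℂ) ∞
      (fun w : Ω => inner ℂ (e.symm w u) (e.symm w v)) e.baseSet

/-! ### Curvature of a line bundle -/

/-- The Wirtinger derivative `∂/∂w_i`. -/
def wirtinger {m : ℕ} (i : Fin m) (f : (Fin m → ℂ) → ℂ) (w : Fin m → ℂ) : ℂ :=
  (1 / 2 : ℂ) * (fderiv ℝ f w (Pi.single i 1)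
    - Complex.I * fderiv ℝ f w (Pi.single i Complex.I))

/-- The Wirtinger derivative `∂/∂w̄_i`. -/
def wirtingerBar {m : ℕ} (i : Fin m) (f : (Fin m → ℂ) → ℂ) (w : Fin m → ℂ) : ℂ :=
  (1 / 2 : ℂ) * (fderiv ℝ f w (Pi.single i 1)
    + Complex.I * fderiv ℝ f w (Pi.single i Complex.I))

open Classical in
/-- `log ‖s‖²` for a section `s` of `E`, as a complex valued function on `ℂ^m`
(with the value `0` off `Ω`). -/
def logNormSq {m : ℕ} {Ω : Opens (Fin m → ℂ)} {E : Ω → Type*} [∀ w, NormedAddCommGroup (E w)]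
    (s : ∀ w : Ω, E w) (x : Fin m → ℂ) : ℂ :=
  if hx : x ∈ Ω then ((Real.log (‖s ⟨x, hx⟩‖ ^ 2) : ℝ) : ℂ) else 0

/-- The curvature matrix `(-∂² log ‖s‖² / ∂w_i ∂w̄_j)` of a holomorphic Hermitian line bundle, where
`s` is a non-vanishing holomorphic section near `w`. (It does not depend on the section; the one
used here is the frame of the preferred holomorphic trivialization at `w`.) -/
def curvatureMatrix {m : ℕ} {Ω : Opens (Fin m → ℂ)}
    (E : Ω → Type*) [∀ w, NormedAddCommGroup (E w)] [∀ w, InnerProductSpace ℂ (E w)]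
    [TopologicalSpace (TotalSpace ℂ E)] [FiberBundle ℂ E] [VectorBundle ℂ ℂ E]
    (w : Ω) : Matrix (Fin m) (Fin m) ℂ :=
  Matrix.of fun i j =>
    - wirtinger i (wirtingerBar j
        (logNormSq (fun z : Ω => (trivializationAt ℂ E w).symm z (1 : ℂ)))) w

/-! ### Positive definite functions and infinitely divisible kernels -/

/-- A positive definite scalar kernel: all the matrices `(K (x_i, x_j))` are nonnegative definite. -/
def IsPositiveDefiniteKernel {X : Type*} (K : X → X → ℂ) : Prop :=
  ∀ (n : ℕ) (x : Fin n → X), (Matrix.of fun i j => K (x i) (x j)).PosSemidef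

/-- A positive definite matrix valued kernel: all the block matrices `(K (x_i, x_j))`
are nonnegative definite. -/
def IsPositiveDefiniteMatrixKernel {X ι : Type*} (K : X → X → Matrix ι ι ℂ) : Prop :=
  ∀ (n : ℕ) (x : Fin n → X),
    (Matrix.of fun p q : Fin n × ι => K (x p.1) (x q.1) p.2 q.2).PosSemidef

/-- A matrix valued function `G` on `Ω` is a positive definite function if it has a polarization
`G'` on `Ω × Ω` (holomorphic in the first and anti-holomorphic in the second variable, with
`G' (w, w) = G w`) which is a positive definite kernel on `Ω`. -/
def IsPositiveDefiniteFunction {m : ℕ} {Ω : Opens (Fin m → ℂ)} {ι : Type*}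
    (G : Ω → Matrix ι ι ℂ) : Prop :=
  ∃ G' : (Fin m → ℂ) → (Fin m → ℂ) → Matrix ι ι ℂ,
    (∀ i j, DifferentiableOn ℂ
      (fun p : (Fin m → ℂ) × (Fin m → ℂ) => G' p.1 (star p.2) i j)
      {p | p.1 ∈ Ω ∧ star p.2 ∈ Ω}) ∧
    (∀ w : Ω, G' w w = G w) ∧
    IsPositiveDefiniteMatrixKernel (fun z w : Ω => G' z w)

/-- A kernel `K` on a connected space is infinitely divisible if it is positive definite and so is
`K^t` for every `t > 0`. Here `K^t = exp (t L)`, with `L` the continuous logarithm of `K` which is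
real on the diagonal (there is at most one such `L`). -/
def IsInfinitelyDivisible {X : Type*} [TopologicalSpace X] (K : X → X → ℂ) : Prop :=
  IsPositiveDefiniteKernel K ∧
  ∃ L : X → X → ℂ, Continuous (fun p : X × X => L p.1 p.2) ∧
    (∀ x, (L x x).im = 0) ∧
    (∀ x y, Complex.exp (L x y) = K x y) ∧
    ∀ t : ℝ, 0 < t → IsPositiveDefiniteKernel (fun x y => Complex.exp ((t : ℂ) * L x y))

/-! ### The Grassmannian and its tautological bundle -/

/-- The Grassmannian `𝒢r(n, H)` of the `n`-dimensional subspaces of `H`. The fibre of the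
tautological bundle over `L : Gr n H` is the subspace `L.1` itself, so that the pullback of the
tautological bundle by `f : B → Gr n H` is the bundle `{(w, x) ∈ B × H | x ∈ f w}`. -/
abbrev Gr (n : ℕ) (H : Type*) [NormedAddCommGroup H] [InnerProductSpace ℂ H] : Type _ :=
  {L : Submodule ℂ H // Module.finrank ℂ L = n}

/-- A map `f : B → 𝒢r(n, H)` is holomorphic if locally there are `n` holomorphic `H`-valued
functions whose values at `w` span `f w`. -/
def IsHolomorphicToGr {V : Type*} [NormedAddCommGroup V] [NormedSpace ℂ V]
    {B : Type*} [TopologicalSpace B] [ChartedSpace V B]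
    {n : ℕ} {H : Type*} [NormedAddCommGroup H] [InnerProductSpace ℂ H] (f : B → Gr n H) : Prop :=
  ∀ w₀ : B, ∃ U : Set B, IsOpen U ∧ w₀ ∈ U ∧ ∃ s : Fin n → B → H,
    (∀ k, MDifferentiableOn 𝓘(ℂ, V) 𝓘(ℂ, H) (s k) U) ∧
    ∀ w ∈ U, (f w).1 = Submodule.span ℂ (Set.range fun k => s k w)

/-- An isomorphism of holomorphic Hermitian bundles over the open set `Ω₀ ⊆ B`, from the restriction
of `E` to the pullback `{(w, x) ∈ Ω₀ × H | x ∈ f w}` of the tautological bundle by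
`f : Ω₀ → 𝒢r(n, H)`: linear isometric isomorphisms of the fibres under which the holomorphic local
sections of the two bundles correspond to each other. The pullback is a subbundle of the trivial
bundle `Ω₀ × H`, so that its fibres carry the inner product of `H`, and a section of it is
holomorphic exactly if it is so as an `H`-valued function. -/
structure IsoPullbackTautological {V : Type*} [NormedAddCommGroup V] [NormedSpace ℂ V]
    {B : Type*} [TopologicalSpace B] [ChartedSpace V B]
    (F : Type*) [NormedAddCommGroup F] [NormedSpace ℂ F]
    (E : B → Type*) [∀ w, NormedAddCommGroup (E w)] [∀ w, InnerProductSpace ℂ (E w)]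
    [TopologicalSpace (TotalSpace F E)] [FiberBundle F E] [VectorBundle ℂ F E]
    (Ω₀ : Opens B) {n : ℕ} {H : Type*} [NormedAddCommGroup H] [InnerProductSpace ℂ H]
    (f : Ω₀ → Gr n H) where
  toIsometry : ∀ w : Ω₀, E w.1 ≃ₗᵢ[ℂ] (f w).1
  holomorphic_iff : ∀ (U : Set Ω₀), IsOpen U → ∀ s : (∀ w : Ω₀, E w.1),
    MDifferentiableOn 𝓘(ℂ, V) (𝓘(ℂ, V).prod 𝓘(ℂ, F))
        (fun w : Ω₀ => (⟨w.1, s w⟩ : TotalSpace F E)) U ↔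
      MDifferentiableOn 𝓘(ℂ, V) 𝓘(ℂ, H) (fun w : Ω₀ => (toIsometry w (s w) : H)) U

end

open Bundle Manifold TopologicalSpace
open scoped ContDiff ComplexOrder

noncomputable section

/-! ### Holomorphic maps between complex normed spaces -/

section Holomorphic

open Metric Filter Set
open scoped Topology

variable {V W : Type*} [NormedAddCommGroup V] [NormedSpace ℂ V]
  [NormedAddCommGroup W] [NormedSpace ℂ W]

/-! On a ball `B` around `w₀` choose a holomorphic frame `s` and put `h = log ‖s‖²`. The hypothesis
says that `∂ᵢ∂̄ⱼ h` has a polarization `G` which is a positive definite kernel. Its Kolmogorov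
decomposition gives holomorphic vectors `Ψᵢ` in a Hilbert space with `⟨Ψᵢ(z), Ψⱼ(w)⟩ = Gᵢⱼ(z, w)`
(`exists_holomorphic_feature_map`).

The form `∑ Ψᵢ dzᵢ` is closed. Indeed, pairing `∂ₖΨᵢ - ∂ᵢΨₖ` with `Ψⱼ(w)` gives a function of `(z,
w)`, holomorphic in `z` and antiholomorphic in `w`. It vanishes on the diagonal because third
derivatives of `h` commute, hence everywhere (`eq_zero_of_diagonal_eq_zero`), and the `Ψⱼ(w)` are
total. A primitive `Φ` satisfies `∂ᵢ∂̄ⱼ ‖Φ‖² = Gᵢⱼ` on the diagonal, so `h - ‖Φ‖²` is pluriharmonic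
and equals `2 Re φ` with `φ` holomorphic (`exists_holomorphic_normSq_add`).

Therefore `‖s‖² = |exp φ|² exp ‖Φ‖²`. By the Schur product theorem `exp (t ⟨Φ(z), Φ(w)⟩)` is
positive definite for all `t > 0`. A second Kolmogorov decomposition, at `t = 1`, gives `γ` with
`⟨γ(z), γ(w)⟩ = exp ⟨Φ(z), Φ(w)⟩` (`exists_local_model`). The bundle isomorphism is `s ↦ exp(φ) γ`,
and `⟨Φ(z), Φ(w)⟩` is the logarithm of the kernel. -/

theorem norm_fderiv_le_of_bounded_on_ball {f : V → W} {c : V} {R M : ℝ} (hR : 0 < R)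
    (hd : DifferentiableOn ℂ f (ball c R)) (hM : ∀ z ∈ ball c R, ‖f z‖ ≤ M) :
    ‖fderiv ℂ f c‖ ≤ 2 * M / R := by
  refine Complex.norm_fderiv_le_div_of_mapsTo_ball hd (fun z hz => ?_) hR
  rw [mem_closedBall, dist_eq_norm]
  have h1 := hM z hz
  have h2 := hM c (mem_ball_self hR)
  have h3 := norm_sub_le (f z) (f c)
  linarith

/-- Higher-order Schwarz lemma for `f` minus its linear part at `c`. That map stays within `4 * M`
of `f c` (`M` from `f z`, `2 * M` from the linear part, `M` from `f c`) and agrees with it to first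
order. The bound depends on `f` only through `M`, which makes later limits uniform. -/
theorem norm_sub_sub_fderiv_le_of_bounded_on_ball {f : V → W} {c z : V} {R M : ℝ}
    (hd : DifferentiableOn ℂ f (ball c R)) (hM : ∀ z ∈ ball c R, ‖f z‖ ≤ M)
    (hz : z ∈ ball c R) :
    ‖f z - f c - fderiv ℂ f c (z - c)‖ ≤ 4 * M * (‖z - c‖ / R) ^ 2 := by
  have hR : 0 < R := nonempty_ball.mp ⟨_, hz⟩
  have hcd : DifferentiableAt ℂ f c := hd.differentiableAt (ball_mem_nhds c hR)
  have hL := norm_fderiv_le_of_bounded_on_ball hR hd hM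
  have key := Complex.dist_le_mul_div_pow_of_mapsTo_ball_of_isLittleO (n := 1) (R₂ := 4 * M)
    (f := fun z => f z - fderiv ℂ f c (z - c)) (c := c) (R₁ := R) (z := z)
    (hd.sub (by fun_prop)) (fun y hy => ?_) ?_ hz
  · simp only [sub_self, map_zero, sub_zero, dist_eq_norm] at key
    rwa [sub_right_comm]
  · have h1 := hM y hy
    have h2 := hM c (mem_ball_self hR)
    have h3 : ‖fderiv ℂ f c (y - c)‖ ≤ 2 * M := by
      refine (ContinuousLinearMap.le_opNorm _ _).trans ?_
      have hy' : ‖y - c‖ ≤ R := by rw [← dist_eq_norm]; exact (mem_ball.mp hy).le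
      calc ‖fderiv ℂ f c‖ * ‖y - c‖ ≤ 2 * M / R * R := by
            gcongr
            exact (norm_nonneg _).trans hL
        _ = 2 * M := by field_simp
    simp only [sub_self, map_zero, sub_zero, mem_closedBall, dist_eq_norm]
    have h4 := norm_sub_le (f y - fderiv ℂ f c (y - c)) (f c)
    have h5 := norm_sub_le (f y) (fderiv ℂ f c (y - c))
    linarith
  · have := hcd.hasFDerivAt.isLittleO
    simp only [sub_self, map_zero, sub_zero, pow_one]
    refine (this.congr_left fun y => by abel).norm_right

/-- A uniform limit of holomorphic maps is holomorphic. -/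
theorem TendstoUniformlyOn.differentiableAt_of_ball [CompleteSpace W] {ι : Type*} {l : Filter ι}
    [l.NeBot] {F : ι → V → W} {f : V → W} {c : V} {R : ℝ} (hR : 0 < R)
    (h : TendstoUniformlyOn F f l (ball c R))
    (hF : ∀ᶠ n in l, DifferentiableOn ℂ (F n) (ball c R)) : DifferentiableAt ℂ f c := by
  have hsub : ∀ z ∈ ball c (R / 2), ball z (R / 2) ⊆ ball c R := fun z hz =>
    ball_subset_ball' (by rw [mem_ball] at hz; linarith)
  have hz' : ∀ z ∈ ball c (R / 2), ball c R ∈ 𝓝 z := fun z hz =>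
    mem_of_superset (ball_mem_nhds z (by positivity)) (hsub z hz)
  have hcau : UniformCauchySeqOn (fun n => fderiv ℂ (F n)) l (ball c (R / 2)) := by
    intro u hu
    obtain ⟨ε, hε, hεu⟩ := Metric.mem_uniformity_dist.mp hu
    -- The Cauchy estimate on balls of radius `R / 2` turns the tolerance `ε * R / 8` into `ε / 2`
    -- for the derivatives.
    have h1 := h.uniformCauchySeqOn _ (Metric.dist_mem_uniformity (show 0 < ε * R / 8 by positivity))
    filter_upwards [h1, hF.prod_mk hF] with n hn hdn z hz
    refine hεu ?_
    have hd : DifferentiableOn ℂ (fun y => F n.1 y - F n.2 y) (ball z (R / 2)) :=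
      (hdn.1.sub hdn.2).mono (hsub z hz)
    have h2 := norm_fderiv_le_of_bounded_on_ball (half_pos hR) hd (M := ε * R / 8) fun y hy => by
      rw [← dist_eq_norm]
      exact le_of_lt (hn y (hsub z hz hy))
    rw [fderiv_fun_sub (hdn.1.differentiableAt (hz' z hz)) (hdn.2.differentiableAt (hz' z hz))] at h2
    rw [dist_eq_norm]
    refine h2.trans_lt ?_
    have : 2 * (ε * R / 8) / (R / 2) = ε / 2 := by field_simp; norm_num
    linarith
  have hlim : ∀ z ∈ ball c (R / 2), ∃ L, Tendsto (fun n => fderiv ℂ (F n) z) l (𝓝 L) :=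
    fun z hz => cauchy_map_iff_exists_tendsto.mp (hcau.cauchy_map hz)
  choose! g' hg' using hlim
  have hunif := hcau.tendstoUniformlyOn_of_tendsto hg'
  have hc : ball c (R / 2) ∈ 𝓝 c := ball_mem_nhds c (half_pos hR)
  have hunif' : TendstoUniformlyOnFilter (fun n => fderiv ℂ (F n)) g' l (𝓝 c) :=
    (tendstoUniformlyOn_iff_tendstoUniformlyOnFilter.mp hunif).mono_right (le_principal_iff.mpr hc)
  refine (hasFDerivAt_of_tendstoUniformlyOnFilter hunif' (f := F) (g := f) ?_ ?_).differentiableAt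
  · filter_upwards [hF.prod_mk hc] with n hn
    exact (hn.1.differentiableAt (hz' _ hn.2)).hasFDerivAt
  · filter_upwards [ball_mem_nhds c hR] with z hz using h.tendsto_at hz

omit [NormedSpace ℂ V] [NormedSpace ℂ W] in
theorem ContinuousAt.exists_ball_norm_le {f : V → W} {c : V} (hf : ContinuousAt f c) {U : Set V}
    (hU : U ∈ 𝓝 c) : ∃ R > 0, ball c R ⊆ U ∧ ∀ z ∈ ball c R, ‖f z‖ ≤ ‖f c‖ + 1 := by
  have h1 : ∀ᶠ z in 𝓝 c, ‖f z‖ < ‖f c‖ + 1 := hf.norm.eventually_lt_const (by linarith)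
  obtain ⟨R, hR, h⟩ := Metric.mem_nhds_iff.mp (inter_mem hU h1)
  exact ⟨R, hR, fun z hz => (h hz).1, fun z hz => (h hz).2.le⟩

/-- The directional derivatives of a holomorphic map are holomorphic. -/
theorem DifferentiableOn.fderiv_apply [CompleteSpace W] {f : V → W} {U : Set V} (hU : IsOpen U)
    (hf : DifferentiableOn ℂ f U) (v : V) : DifferentiableOn ℂ (fun z => fderiv ℂ f z v) U := by
  intro c hc
  refine DifferentiableAt.differentiableWithinAt ?_
  obtain ⟨R, hR, hRU, hM⟩ := (hf.differentiableAt (hU.mem_nhds hc)).continuousAt.exists_ball_norm_le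
    (hU.mem_nhds hc)
  set M := ‖f c‖ + 1
  have hM0 : 0 < M := by positivity
  have hdR : DifferentiableOn ℂ f (ball c R) := hf.mono hRU
  have hsub : ∀ z ∈ ball c (R / 2), ball z (R / 2) ⊆ ball c R := fun z hz =>
    ball_subset_ball' (by rw [mem_ball] at hz; linarith)
  have hsmall : ∀ᶠ t : ℂ in 𝓝[≠] 0, ‖t • v‖ < R / 2 := by
    have : Tendsto (fun t : ℂ => ‖t • v‖) (𝓝[≠] 0) (𝓝 0) := by
      have : Continuous fun t : ℂ => ‖t • v‖ := by fun_prop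
      simpa using (this.tendsto 0).mono_left nhdsWithin_le_nhds
    exact this.eventually_lt_const (by positivity)
  -- The directional derivative is a limit of difference quotients, each holomorphic in `z`. The
  -- quadratic remainder bound makes their error `O(‖t‖)` uniformly on the half ball.
  refine TendstoUniformlyOn.differentiableAt_of_ball (half_pos hR) (l := 𝓝[≠] (0 : ℂ))
    (F := fun t z => t⁻¹ • (f (z + t • v) - f z)) ?_ ?_
  · rw [Metric.tendstoUniformlyOn_iff]
    intro ε hε
    have hlim : Tendsto (fun t : ℂ => 4 * M * (‖v‖ / (R / 2)) ^ 2 * ‖t‖) (𝓝[≠] 0) (𝓝 0) := by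
      have : Continuous fun t : ℂ => 4 * M * (‖v‖ / (R / 2)) ^ 2 * ‖t‖ := by fun_prop
      simpa using (this.tendsto 0).mono_left nhdsWithin_le_nhds
    filter_upwards [hlim.eventually_lt_const hε, hsmall, self_mem_nhdsWithin] with t ht hts ht0 z hz
    have ht0' : t ≠ 0 := ht0
    refine lt_of_le_of_lt ?_ ht
    have key := norm_sub_sub_fderiv_le_of_bounded_on_ball (c := z) (z := z + t • v)
      (hdR.mono (hsub z hz)) (fun y hy => hM y (hsub z hz hy)) (by simpa using hts)
    rw [add_sub_cancel_left, map_smul] at key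
    rw [dist_comm, dist_eq_norm]
    have e1 : t⁻¹ • (f (z + t • v) - f z) - fderiv ℂ f z v
        = t⁻¹ • (f (z + t • v) - f z - t • fderiv ℂ f z v) := by
      rw [smul_sub _ _ (t • _), smul_smul, inv_mul_cancel₀ ht0', one_smul]
    rw [e1, norm_smul, norm_inv]
    have htn : 0 < ‖t‖ := norm_pos_iff.mpr ht0'
    rw [inv_mul_le_iff₀ htn]
    refine key.trans_eq ?_
    rw [norm_smul]
    ring
  · filter_upwards [hsmall] with t ht
    refine DifferentiableOn.const_smul (DifferentiableOn.sub ?_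
      (hdR.mono (ball_subset_ball (by linarith)))) _
    refine hdR.comp (by fun_prop) fun z hz => hsub z hz (by simpa using ht)

/-- Directional derivatives are again holomorphic, and in finite dimension smoothness of the
differential can be tested on vectors, so one inducts on the order. -/
theorem DifferentiableOn.contDiffOn_of_finiteDimensional [CompleteSpace W] [FiniteDimensional ℂ V]
    {U : Set V} (hU : IsOpen U) {f : V → W} (hf : DifferentiableOn ℂ f U) :
    ContDiffOn ℂ ∞ f U := by
  rw [contDiffOn_infty]
  intro n
  induction n generalizing f with
  | zero => exact contDiffOn_zero.mpr hf.continuousOn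
  | succ n ih =>
    push_cast
    refine (contDiffOn_succ_iff_fderiv_of_isOpen hU).mpr ⟨hf, by simp, ?_⟩
    exact contDiffOn_clm_apply.mpr fun v => ih (hf.fderiv_apply hU v)

/-- A function of `z` and `w`, holomorphic in `z` and antiholomorphic in `w`, which vanishes on the
diagonal of a convex open set, vanishes identically. -/
theorem eq_zero_of_diagonal_eq_zero {m : ℕ} {U : Set (Fin m → ℂ)} (hU : IsOpen U)
    (hconv : Convex ℝ U) {f : (Fin m → ℂ) × (Fin m → ℂ) → ℂ}
    (hf : DifferentiableOn ℂ f {p | p.1 ∈ U ∧ star p.2 ∈ U})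
    (hdiag : ∀ w ∈ U, f (w, star w) = 0) {z w : Fin m → ℂ} (hz : z ∈ U) (hw : w ∈ U) :
    f (z, star w) = 0 := by
  -- Restrict `f` to the complex line `ζ ↦ (p + ζ • d, star p + ζ • star d)`: real `ζ` lands on the
  -- diagonal, and `ζ = I` gives `(z, star w)`. The identity theorem on the convex set `S` of
  -- admissible `ζ` then applies, with zeros accumulating at `0` along the reals.
  set p : Fin m → ℂ := (2⁻¹ : ℂ) • (z + w) with hp
  set d : Fin m → ℂ := (2⁻¹ : ℂ) • (-Complex.I) • (z - w) with hd
  have hId : Complex.I • d = (2⁻¹ : ℂ) • (z - w) := by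
    rw [hd, smul_comm, smul_smul Complex.I]; simp
  have hz' : p + Complex.I • d = z := by
    rw [hId, hp, ← smul_add, add_add_sub_cancel, ← two_smul ℂ z, smul_smul]; simp
  have hw' : p - Complex.I • d = w := by
    rw [hId, hp, ← smul_sub, add_sub_sub_cancel, ← two_smul ℂ w, smul_smul]; simp
  have hpU : p ∈ U := by
    have := hconv hz hw (a := 2⁻¹) (b := 2⁻¹) (by norm_num) (by norm_num) (by norm_num)
    convert this using 1
    rw [hp, smul_add]
    congr 1 <;> ext i <;> simp
  set l : ℂ → (Fin m → ℂ) := fun ζ => p + ζ • d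
  have hl : Continuous l := by fun_prop
  set S : Set ℂ := {ζ | l ζ ∈ U ∧ l (star ζ) ∈ U} with hS
  have hSo : IsOpen S := (hU.preimage hl).inter (hU.preimage (hl.comp continuous_star))
  have haff : ∀ (a b : ℝ) (ζ η : ℂ), a + b = 1 → l (a • ζ + b • η) = a • l ζ + b • l η := by
    intro a b ζ η hab
    have hab' : (a : ℂ) + b = 1 := by exact_mod_cast hab
    ext i
    simp only [l, Pi.add_apply, Pi.smul_apply, smul_eq_mul, Complex.real_smul]
    linear_combination (-(p i)) * hab'
  have hSc : Convex ℝ S := by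
    intro ζ hζ η hη a b ha hb hab
    refine ⟨?_, ?_⟩
    · rw [haff a b _ _ hab]; exact hconv hζ.1 hη.1 ha hb hab
    · rw [star_add, star_smul, star_smul, star_trivial a, star_trivial b, haff a b _ _ hab]
      exact hconv hζ.2 hη.2 ha hb hab
  set g : ℂ → ℂ := fun ζ => f (p + ζ • d, star p + ζ • star d) with hg
  have hstar : ∀ ζ : ℂ, star (star p + ζ • star d) = l (star ζ) := by
    intro ζ; simp [l]
  have hgd : DifferentiableOn ℂ g S := by
    refine hf.comp (by fun_prop) fun ζ hζ => ⟨hζ.1, ?_⟩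
    change star (star p + ζ • star d) ∈ U
    rw [hstar]; exact hζ.2
  have h0 : (0 : ℂ) ∈ S := by simp [hS, l, hpU]
  have hI : Complex.I ∈ S := by
    refine ⟨by simp only [l]; rwa [hz'], ?_⟩
    simp only [l, Complex.star_def, Complex.conj_I, neg_smul, ← sub_eq_add_neg]; rwa [hw']
  have hfreq : ∃ᶠ ζ in 𝓝[≠] (0 : ℂ), g ζ = 0 := by
    have ht : Tendsto (fun n : ℕ => ((1 / ((n : ℝ) + 1) : ℝ) : ℂ)) atTop (𝓝[≠] 0) := by
      refine tendsto_nhdsWithin_iff.mpr ⟨?_, Eventually.of_forall fun n => ?_⟩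
      · have := (Complex.continuous_ofReal.tendsto 0).comp
          (tendsto_one_div_add_atTop_nhds_zero_nat (𝕜 := ℝ))
        simpa [Function.comp_def] using this
      · have : (1 / ((n : ℝ) + 1)) ≠ 0 := by positivity
        exact Complex.ofReal_ne_zero.mpr this
    refine ht.frequently (Eventually.frequently ?_)
    have hSn : S ∈ 𝓝[≠] (0 : ℂ) := nhdsWithin_le_nhds (hSo.mem_nhds h0)
    filter_upwards [ht.eventually hSn] with n hn
    have := hdiag _ hn.1
    simp only [hg]
    convert this using 2
    simp [l]
  have := (hgd.analyticOnNhd hSo).eqOn_zero_of_preconnected_of_frequently_eq_zero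
    hSc.isPreconnected h0 hfreq hI
  simp only [hg, hz', Pi.zero_apply] at this
  rw [← this]
  congr 2
  rw [← hw']
  simp

/-! ### Weak holomorphy implies strong holomorphy -/

section Weak

variable {H : Type*} [NormedAddCommGroup H] [InnerProductSpace ℂ H]

theorem Dense.norm_le_of_norm_inner_le {D : Set H} (hD : Dense D) {y : H} {C : ℝ} (hC : 0 ≤ C)
    (h : ∀ x ∈ D, ‖inner ℂ x y‖ ≤ C * ‖x‖) : ‖y‖ ≤ C := by
  have hall : ∀ x : H, ‖inner ℂ x y‖ ≤ C * ‖x‖ := by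
    have hcl : IsClosed {x : H | ‖inner ℂ x y‖ ≤ C * ‖x‖} :=
      isClosed_le (by fun_prop) (by fun_prop)
    exact fun x => hcl.closure_subset_iff.mpr h (hD x)
  rcases eq_or_ne y 0 with rfl | hy
  · simpa using hC
  · have h1 := hall y
    rw [inner_self_eq_norm_sq_to_K, norm_pow] at h1
    have h2 := norm_pos_iff.mpr hy
    simp only [Complex.coe_algebraMap, Complex.norm_real, norm_norm] at h1
    nlinarith

/-- A bounded map into a Hilbert space is complex differentiable if its inner products with the
elements of a dense subset are holomorphic. -/
theorem differentiableAt_of_differentiableOn_inner [CompleteSpace H] {m : ℕ}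
    {F : (Fin m → ℂ) → H} {c : Fin m → ℂ} {R M : ℝ} (hR : 0 < R)
    (hM : ∀ z ∈ ball c R, ‖F z‖ ≤ M) {D : Set H} (hD : Dense D)
    (hF : ∀ x ∈ D, DifferentiableOn ℂ (fun z => inner ℂ x (F z)) (ball c R)) :
    DifferentiableAt ℂ F c := by
  have hM0 : 0 ≤ M := (norm_nonneg _).trans (hM c (mem_ball_self hR))
  set L : H → ((Fin m → ℂ) →L[ℂ] ℂ) := fun x => fderiv ℂ (fun z => inner ℂ x (F z)) c
  -- The remainder bound is linear in `‖x‖`, so the estimates tested on `D` become norm estimates in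
  -- `H`.
  have hrem : ∀ x ∈ D, ∀ z ∈ ball c R,
      ‖inner ℂ x (F z - F c) - L x (z - c)‖ ≤ 4 * M * (‖z - c‖ / R) ^ 2 * ‖x‖ := by
    intro x hx z hz
    have := norm_sub_sub_fderiv_le_of_bounded_on_ball (M := ‖x‖ * M) (hF x hx) (fun y hy =>
      (norm_inner_le_norm _ _).trans (by gcongr; exact hM y hy)) hz
    rw [inner_sub_right]
    exact this.trans_eq (by ring)
  -- Along `t n → 0` the difference quotients are Cauchy in norm, because tested against `x ∈ D`
  -- they lie within `C * t n * ‖x‖` of `L x v`. Completeness gives `d`.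
  have hdir : ∀ v : Fin m → ℂ, ∃ d : H, ∀ x ∈ D, inner ℂ x d = L x v := by
    intro v
    set C := 4 * M * (‖v‖ / R) ^ 2 with hC
    have hC0 : 0 ≤ C := by positivity
    have hq : ∀ t : ℝ, 0 < t → ‖t • v‖ < R → ∀ x ∈ D,
        ‖inner ℂ x (((t : ℂ)⁻¹) • (F (c + (t : ℂ) • v) - F c)) - L x v‖ ≤ C * t * ‖x‖ := by
      intro t ht htv x hx
      have ht' : (t : ℂ) ≠ 0 := by exact_mod_cast ht.ne'
      have h1 := hrem x hx (c + (t : ℂ) • v) (by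
        rw [mem_ball, dist_eq_norm, add_sub_cancel_left]
        simpa [norm_smul] using htv)
      rw [add_sub_cancel_left, map_smul] at h1
      have e1 : inner ℂ x (((t : ℂ)⁻¹) • (F (c + (t : ℂ) • v) - F c)) - L x v
          = (t : ℂ)⁻¹ * (inner ℂ x (F (c + (t : ℂ) • v) - F c) - (t : ℂ) • L x v) := by
        rw [inner_smul_right, smul_eq_mul]
        field_simp
      rw [e1, norm_mul, norm_inv, Complex.norm_real, Real.norm_of_nonneg ht.le,
        inv_mul_le_iff₀ ht]
      refine h1.trans_eq ?_
      rw [norm_smul, Complex.norm_real, Real.norm_of_nonneg ht.le, hC]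
      ring
    obtain ⟨ε, hε, hεv⟩ : ∃ ε : ℝ, 0 < ε ∧ ε * ‖v‖ < R :=
      -- The `+ 1` covers `v = 0`.
      ⟨R / (‖v‖ + 1), by positivity, by
        rw [div_mul_eq_mul_div, div_lt_iff₀ (by positivity)]; nlinarith [norm_nonneg v]⟩
    set t : ℕ → ℝ := fun n => ε * (1 / ((n : ℝ) + 1)) with ht
    have ht0 : ∀ n, 0 < t n := fun n => by positivity
    have htle : ∀ n, t n ≤ ε := fun n => by
      have : 1 / ((n : ℝ) + 1) ≤ 1 := by
        rw [div_le_one (by positivity)]; linarith [(Nat.cast_nonneg n : (0 : ℝ) ≤ n)]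
      simp only [ht]
      nlinarith
    have htv : ∀ n, ‖t n • v‖ < R := fun n => by
      rw [norm_smul, Real.norm_of_nonneg (ht0 n).le]
      exact (mul_le_mul_of_nonneg_right (htle n) (norm_nonneg v)).trans_lt hεv
    have htanti : Antitone t := fun a b hab => by
      simp only [ht]
      gcongr
    have htlim : Tendsto t atTop (𝓝 0) := by
      simpa [ht] using (tendsto_one_div_add_atTop_nhds_zero_nat (𝕜 := ℝ)).const_mul ε
    set q : ℕ → H := fun n => ((t n : ℂ)⁻¹) • (F (c + (t n : ℂ) • v) - F c)
    have hqn : ∀ n, ∀ x ∈ D, ‖inner ℂ x (q n) - L x v‖ ≤ C * t n * ‖x‖ := fun n =>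
      hq (t n) (ht0 n) (htv n)
    have hcau : CauchySeq q := by
      refine cauchySeq_of_le_tendsto_0 (fun n => 2 * C * t n) (fun n k N hn hk => ?_)
        (by simpa using htlim.const_mul (2 * C))
      rw [dist_eq_norm]
      refine hD.norm_le_of_norm_inner_le (by have := ht0 N; positivity) fun x hx => ?_
      have e : inner ℂ x (q n - q k)
          = (inner ℂ x (q n) - L x v) - (inner ℂ x (q k) - L x v) := by
        rw [inner_sub_right]; ring
      rw [e]
      have h1 : C * t n * ‖x‖ ≤ C * t N * ‖x‖ := by gcongr; exact htanti hn
      have h2 : C * t k * ‖x‖ ≤ C * t N * ‖x‖ := by gcongr; exact htanti hk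
      have h3 := norm_sub_le (inner ℂ x (q n) - L x v) (inner ℂ x (q k) - L x v)
      linarith [hqn n x hx, hqn k x hx]
    obtain ⟨d, hd⟩ := cauchySeq_tendsto_of_complete hcau
    refine ⟨d, fun x hx => tendsto_nhds_unique
      ((Continuous.tendsto (by fun_prop) d).comp hd : Tendsto (fun n => inner ℂ x (q n)) _ _) ?_⟩
    rw [tendsto_iff_norm_sub_tendsto_zero]
    refine squeeze_zero (fun _ => norm_nonneg _) (fun n => hqn n x hx) ?_
    simpa using (htlim.const_mul C).mul_const ‖x‖
  choose d hd using hdir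
  set A : (Fin m → ℂ) →L[ℂ] H :=
    ∑ i, (ContinuousLinearMap.proj i : (Fin m → ℂ) →L[ℂ] ℂ).smulRight (d (Pi.single i 1))
  have hA : ∀ x ∈ D, ∀ v, inner ℂ x (A v) = L x v := by
    intro x hx v
    conv_rhs => rw [pi_eq_sum_univ' v]
    simp only [A, sum_apply, ContinuousLinearMap.smulRight_apply,
      ContinuousLinearMap.proj_apply, inner_sum, inner_smul_right, hd _ x hx, map_sum, map_smul,
      smul_eq_mul]
  have hbig : (fun z => F z - F c - A (z - c)) =O[𝓝 c] fun z => ‖z - c‖ ^ 2 := by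
    refine Asymptotics.IsBigO.of_bound (4 * M / R ^ 2) ?_
    filter_upwards [ball_mem_nhds c hR] with z hz
    rw [norm_pow, norm_norm]
    refine hD.norm_le_of_norm_inner_le (by positivity) fun x hx => ?_
    rw [inner_sub_right, hA x hx]
    exact (hrem x hx z hz).trans_eq (by ring)
  have h0 := hbig.hasFDerivAt (𝕜 := ℂ) one_lt_two
  have h1 := (h0.add (A.hasFDerivAt.comp c ((hasFDerivAt_id c).sub_const c))).add_const (F c)
  refine (h1.congr_of_eventuallyEq (Eventually.of_forall fun z => ?_)).differentiableAt
  simp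

end Weak

end Holomorphic

/-! ### Holomorphic feature maps of positive definite kernels -/

section FeatureMap

open Metric Filter Set
open scoped Topology ComplexConjugate

/-- Only finitely many indices matter at a time: two for Hermitian symmetry, and the support of the
vector for the quadratic form. -/
theorem Matrix.PosSemidef.of_submatrix_fin {X : Type*} {M : Matrix X X ℂ}
    (h : ∀ (n : ℕ) (x : Fin n → X), (M.submatrix x x).PosSemidef) : M.PosSemidef := by
  refine ⟨?_, fun f => ?_⟩
  · ext a b
    have := (h 2 ![a, b]).isHermitian.apply 0 1
    simpa using this
  · set e := f.support.equivFin
    have h1 := (h _ (fun k => (e.symm k : X))).2 (Finsupp.equivFunOnFinite.symm fun k => f (e.symm k))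
    refine h1.trans_eq ?_
    have key : ∀ g : X → ℂ, ∑ k, g (e.symm k) = ∑ a ∈ f.support, g a := fun g => by
      rw [← Finset.sum_coe_sort f.support]
      exact Equiv.sum_comp e.symm (fun a : f.support => g a)
    rw [Finsupp.sum_fintype _ _ (by simp), Finsupp.sum]
    rw [← key]
    refine Finset.sum_congr rfl fun k _ => ?_
    rw [Finsupp.sum_fintype _ _ (by simp), Finsupp.sum, ← key]
    rfl

theorem IsPositiveDefiniteKernel.posSemidef {X : Type*} {K : X → X → ℂ}
    (h : IsPositiveDefiniteKernel K) : (Matrix.of K).PosSemidef :=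
  Matrix.PosSemidef.of_submatrix_fin h

/-- The Kolmogorov decomposition of a positive semidefinite matrix. -/
theorem Matrix.PosSemidef.exists_hilbert {X : Type} {M : Matrix X X ℂ} (hM : M.PosSemidef) :
    ∃ (H : Type) (_ : NormedAddCommGroup H) (_ : InnerProductSpace ℂ H) (_ : CompleteSpace H)
      (k : X → H), (∀ a b, inner ℂ (k b) (k a) = M a b) ∧
        Dense (Submodule.span ℂ (range k) : Set H) := by
  -- The scalar kernel acts on `ℂ` by multiplication. The indices are swapped because `inner` is
  -- conjugate-linear in its first argument.
  set N : Matrix X X (ℂ →L[ℂ] ℂ) := Matrix.of fun a b => M b a • ContinuousLinearMap.id ℂ ℂ with hN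
  have hNa : ∀ a b w, N a b w = M b a * w := fun a b w => by simp [hN]
  have hpos : N.PosSemidef := by
    have htfae := (RKHS.posSemidef_tfae (K := N)).out 0 2
    refine htfae.mpr ⟨?_, fun f => ?_⟩
    · ext a b
      refine ext_inner_left ℂ fun v => ?_
      rw [Matrix.conjTranspose_apply, ContinuousLinearMap.star_eq_adjoint,
        ContinuousLinearMap.adjoint_inner_right, hNa, hNa]
      simp [← hM.isHermitian.apply a b]
    · have h := hM.transpose.2 f
      have e : (f.sum fun x w => f.sum fun x' w' => inner ℂ (N x' x w) w')
          = f.sum fun x w => f.sum fun x' w' => star w * M.transpose x x' * w' := by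
        refine Finsupp.sum_congr fun x _ => Finsupp.sum_congr fun x' _ => ?_
        rw [hNa, RCLike.inner_apply, map_mul, Matrix.transpose_apply]
        rw [← hM.isHermitian.apply x' x]
        simp only [Complex.star_def]
        ring
      rw [e]
      exact (RCLike.le_iff_re_im.mp h).1.trans_eq' (by simp)
  have : Fact N.PosSemidef := ⟨hpos⟩
  refine ⟨RKHS.OfKernel N, inferInstance, inferInstance, inferInstance,
    fun a => RKHS.kerFun (RKHS.OfKernel N) a 1, fun a b => ?_, ?_⟩
  · have := RKHS.kernel_inner (H := RKHS.OfKernel N) a b (1 : ℂ) 1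
    rw [RKHS.OfKernel.kernel_ofKernel, hNa] at this
    rw [← hM.isHermitian.apply a b]
    rw [← this]
    simp [RCLike.inner_apply]
  · have := RKHS.kerFun_dense (H := RKHS.OfKernel N)
    rw [Submodule.dense_iff_topologicalClosure_eq_top, ← top_le_iff, ← this]
    refine Submodule.topologicalClosure_mono (Submodule.span_le.mpr ?_)
    rintro _ ⟨a, v, rfl⟩
    have e : RKHS.kerFun (RKHS.OfKernel N) a v = v • RKHS.kerFun (RKHS.OfKernel N) a 1 := by
      rw [← map_smul, smul_eq_mul, mul_one]
    rw [e]
    exact Submodule.smul_mem _ _ (Submodule.subset_span ⟨a, rfl⟩)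

/-- A positive definite matrix valued kernel which is holomorphic in the first and antiholomorphic
in the second variable is the Gram kernel of a family of holomorphic maps into a Hilbert space. -/
theorem exists_holomorphic_feature_map {m : ℕ} {ι : Type} [Countable ι] {U : Set (Fin m → ℂ)}
    (hU : IsOpen U) (K : ι → ι → (Fin m → ℂ) → (Fin m → ℂ) → ℂ)
    (hd : ∀ i j, DifferentiableOn ℂ (fun p : (Fin m → ℂ) × (Fin m → ℂ) => K i j p.1 (star p.2))
      {p | p.1 ∈ U ∧ star p.2 ∈ U})
    (hpos : (Matrix.of fun a b : U × ι => K a.2 b.2 a.1 b.1).PosSemidef) :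
    ∃ (H : Type) (_ : NormedAddCommGroup H) (_ : InnerProductSpace ℂ H) (_ : CompleteSpace H)
      (_ : SeparableSpace H) (Φ : ι → (Fin m → ℂ) → H),
      (∀ i, DifferentiableOn ℂ (Φ i) U) ∧
      (∀ i j, ∀ z ∈ U, ∀ w ∈ U, inner ℂ (Φ j w) (Φ i z) = K i j z w) ∧
      (∀ y : H, (∀ j, ∀ w ∈ U, inner ℂ (Φ j w) y = 0) → y = 0) := by
  classical
  obtain ⟨H, _, _, _, k, hk, hdense⟩ := hpos.exists_hilbert
  set Φ : ι → (Fin m → ℂ) → H := fun i z => if h : z ∈ U then k (⟨z, h⟩, i) else 0 with hΦ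
  have hΦk : ∀ i z (h : z ∈ U), Φ i z = k (⟨z, h⟩, i) := fun i z h => dif_pos h
  have hin : ∀ i j, ∀ z ∈ U, ∀ w ∈ U, inner ℂ (Φ j w) (Φ i z) = K i j z w := by
    intro i j z hz w hw
    rw [hΦk _ _ hz, hΦk _ _ hw, hk]
    rfl
  -- Weak holomorphy is clear against the kernel vectors and extends to their dense span. With local
  -- boundedness, read off the continuous diagonal of `K`, it upgrades to holomorphy in norm.
  have hspan : ∀ x ∈ Submodule.span ℂ (range k), ∀ i,
      DifferentiableOn ℂ (fun z => inner ℂ x (Φ i z)) U := by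
    intro x hx i
    induction hx using Submodule.span_induction with
    | mem x hx =>
      obtain ⟨⟨⟨w, hw⟩, j⟩, rfl⟩ := hx
      have h1 : DifferentiableOn ℂ (fun z => K i j z w) U := by
        have := (hd i j).comp (t := {p | p.1 ∈ U ∧ star p.2 ∈ U}) (s := U)
          (f := fun z => (z, star w)) (by fun_prop) (fun z hz => ⟨hz, by simpa using hw⟩)
        simpa [Function.comp_def] using this
      refine h1.congr fun z hz => ?_
      rw [← hin i j z hz w hw, hΦk _ _ hw]
    | zero => simp
    | add x y _ _ hx hy => simp only [inner_add_left]; exact hx.fun_add hy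
    | smul a x _ hx => simp only [inner_smul_left]; exact hx.const_mul (conj a)
  have hnorm : ∀ i, ContinuousOn (fun z => ‖Φ i z‖ ^ 2) U := by
    intro i
    have h1 : ContinuousOn (fun z => K i i z z) U := by
      have := (hd i i).continuousOn.comp (t := {p | p.1 ∈ U ∧ star p.2 ∈ U}) (s := U)
          (f := fun z => (z, star z)) (by fun_prop) (fun z hz => ⟨hz, by simpa using hz⟩)
      simpa [Function.comp_def] using this
    refine (Complex.continuous_re.comp_continuousOn h1).congr fun z hz => ?_
    simp only [Function.comp_apply, ← hin i i z hz z hz]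
    rw [← inner_self_eq_norm_sq (𝕜 := ℂ)]
    rfl
  have hdiff : ∀ i, DifferentiableOn ℂ (Φ i) U := by
    intro i c hc
    obtain ⟨R, hR, hRU, hM⟩ := ((hnorm i).continuousAt (hU.mem_nhds hc)).exists_ball_norm_le
      (hU.mem_nhds hc)
    -- What is bounded nearby is `‖Φ i z‖ ^ 2`; the extra `+ 1` comes from `x ≤ x ^ 2 + 1`.
    refine (differentiableAt_of_differentiableOn_inner hR (M := ‖‖Φ i c‖ ^ 2‖ + 1 + 1)
      (fun z hz => ?_) hdense fun x hx => (hspan x hx i).mono hRU).differentiableWithinAt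
    have := hM z hz
    rw [norm_pow, norm_norm] at this
    nlinarith [norm_nonneg (Φ i z), norm_nonneg (‖Φ i c‖ ^ 2)]
  have htot : ∀ y : H, (∀ j, ∀ w ∈ U, inner ℂ (Φ j w) y = 0) → y = 0 := by
    intro y hy
    refine hdense.eq_zero_of_inner_right ℂ fun x hx => ?_
    induction hx using Submodule.span_induction with
    | mem x hx =>
      obtain ⟨⟨⟨w, hw⟩, j⟩, rfl⟩ := hx
      rw [← hΦk]
      exact hy j w hw
    | zero => simp
    | add x y _ _ hx hy => rw [inner_add_left, hx, hy, add_zero]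
    | smul a x _ hx => rw [inner_smul_left, hx, mul_zero]
  have hsep : SeparableSpace H := by
    have h1 : IsSeparable (range k) := by
      -- Separability: the generators lie in countably many continuous images of the separable set
      -- `U`.
      have : range k ⊆ ⋃ i, Φ i '' U := by
        rintro _ ⟨⟨⟨z, hz⟩, i⟩, rfl⟩
        exact mem_iUnion.mpr ⟨i, z, hz, hΦk i z hz⟩
      refine (IsSeparable.iUnion fun i => ?_).mono this
      rw [image_eq_range]
      have := continuousOn_iff_continuous_domRestrict.mp (hdiff i).continuousOn
      exact isSeparable_range this
    have h2 := (h1.span (R := ℂ)).closure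
    rw [hdense.closure_eq] at h2
    exact isSeparable_univ_iff.mp h2
  exact ⟨H, _, _, ‹_›, hsep, Φ, hdiff, hin, htot⟩

end FeatureMap

/-! ### Wirtinger calculus -/

section Wirtinger

open Metric Filter Set
open scoped Topology ComplexConjugate

variable {m : ℕ}

theorem wirtinger_congr {f g : (Fin m → ℂ) → ℂ} {w : Fin m → ℂ} (h : f =ᶠ[𝓝 w] g) (i : Fin m) :
    wirtinger i f w = wirtinger i g w := by
  simp only [wirtinger, h.fderiv_eq]

theorem wirtingerBar_congr {f g : (Fin m → ℂ) → ℂ} {w : Fin m → ℂ} (h : f =ᶠ[𝓝 w] g)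
    (i : Fin m) : wirtingerBar i f w = wirtingerBar i g w := by
  simp only [wirtingerBar, h.fderiv_eq]

theorem wirtingerBar_eventuallyEq {f g : (Fin m → ℂ) → ℂ} {w : Fin m → ℂ} (h : f =ᶠ[𝓝 w] g)
    (i : Fin m) : wirtingerBar i f =ᶠ[𝓝 w] wirtingerBar i g := by
  filter_upwards [h.eventuallyEq_nhds] with z hz using wirtingerBar_congr hz i

theorem wirtinger_add {f g : (Fin m → ℂ) → ℂ} {w : Fin m → ℂ} (hf : DifferentiableAt ℝ f w)
    (hg : DifferentiableAt ℝ g w) (i : Fin m) :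
    wirtinger i (fun z => f z + g z) w = wirtinger i f w + wirtinger i g w := by
  simp only [wirtinger, fderiv_fun_add hf hg, add_apply]
  ring

theorem wirtingerBar_add {f g : (Fin m → ℂ) → ℂ} {w : Fin m → ℂ} (hf : DifferentiableAt ℝ f w)
    (hg : DifferentiableAt ℝ g w) (i : Fin m) :
    wirtingerBar i (fun z => f z + g z) w = wirtingerBar i f w + wirtingerBar i g w := by
  simp only [wirtingerBar, fderiv_fun_add hf hg, add_apply]
  ring

theorem wirtinger_sub {f g : (Fin m → ℂ) → ℂ} {w : Fin m → ℂ} (hf : DifferentiableAt ℝ f w)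
    (hg : DifferentiableAt ℝ g w) (i : Fin m) :
    wirtinger i (fun z => f z - g z) w = wirtinger i f w - wirtinger i g w := by
  simp only [wirtinger, fderiv_fun_sub hf hg, sub_apply]
  ring

theorem wirtingerBar_sub {f g : (Fin m → ℂ) → ℂ} {w : Fin m → ℂ} (hf : DifferentiableAt ℝ f w)
    (hg : DifferentiableAt ℝ g w) (i : Fin m) :
    wirtingerBar i (fun z => f z - g z) w = wirtingerBar i f w - wirtingerBar i g w := by
  simp only [wirtingerBar, fderiv_fun_sub hf hg, sub_apply]
  ring

theorem single_I_eq_smul (i : Fin m) :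
    (Pi.single i Complex.I : Fin m → ℂ) = Complex.I • Pi.single i 1 := by
  rw [← Pi.single_smul, smul_eq_mul, mul_one]

/-- The differential of a function in terms of its Wirtinger derivatives. -/
theorem fderiv_eq_sum_wirtinger (f : (Fin m → ℂ) → ℂ) (w v : Fin m → ℂ) :
    fderiv ℝ f w v = ∑ i, (v i * wirtinger i f w + conj (v i) * wirtingerBar i f w) := by
  have hv : v = ∑ i, ((v i).re • (Pi.single i 1 : Fin m → ℂ)
      + (v i).im • (Pi.single i Complex.I : Fin m → ℂ)) := by
    conv_lhs => rw [pi_eq_sum_univ' v]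
    refine Finset.sum_congr rfl fun i _ => ?_
    ext k
    rcases eq_or_ne k i with rfl | hk
    · simp [Complex.re_add_im]
    · simp [hk]
  conv_lhs => rw [hv]
  rw [map_sum]
  refine Finset.sum_congr rfl fun i _ => ?_
  rw [map_add, map_smul, map_smul, wirtinger, wirtingerBar, Complex.real_smul, Complex.real_smul]
  conv_rhs => rw [← Complex.re_add_im (v i)]
  simp only [map_add, map_mul, Complex.conj_ofReal, Complex.conj_I]
  linear_combination ((v i).im * fderiv ℝ f w (Pi.single i Complex.I)) * Complex.I_sq

/-- Cauchy–Riemann: without its `∂̄` terms the real differential is complex linear. -/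
theorem differentiableAt_of_wirtingerBar_eq_zero {f : (Fin m → ℂ) → ℂ} {w : Fin m → ℂ}
    (hf : DifferentiableAt ℝ f w) (h : ∀ j, wirtingerBar j f w = 0) : DifferentiableAt ℂ f w := by
  refine (hasFDerivAt_of_restrictScalars ℝ hf.hasFDerivAt (f' := ∑ i, (wirtinger i f w) •
    (ContinuousLinearMap.proj i : (Fin m → ℂ) →L[ℂ] ℂ)) ?_).differentiableAt
  ext v
  simp [fderiv_eq_sum_wirtinger, h, mul_comm]

theorem wirtinger_eq_fderiv {f : (Fin m → ℂ) → ℂ} {w : Fin m → ℂ}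
    (hf : DifferentiableAt ℂ f w) (i : Fin m) :
    wirtinger i f w = fderiv ℂ f w (Pi.single i 1) := by
  rw [wirtinger, (hf.hasFDerivAt.restrictScalars ℝ).fderiv, single_I_eq_smul]
  simp only [ContinuousLinearMap.coe_restrictScalars', map_smul, smul_eq_mul]
  linear_combination (-(1 / 2 : ℂ) * fderiv ℂ f w (Pi.single i 1)) * Complex.I_sq

theorem wirtingerBar_eq_zero {f : (Fin m → ℂ) → ℂ} {w : Fin m → ℂ}
    (hf : DifferentiableAt ℂ f w) (i : Fin m) : wirtingerBar i f w = 0 := by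
  rw [wirtingerBar, (hf.hasFDerivAt.restrictScalars ℝ).fderiv, single_I_eq_smul]
  simp only [ContinuousLinearMap.coe_restrictScalars', map_smul, smul_eq_mul]
  linear_combination ((1 / 2 : ℂ) * fderiv ℂ f w (Pi.single i 1)) * Complex.I_sq

theorem wirtingerBar_conj {f : (Fin m → ℂ) → ℂ} {w : Fin m → ℂ} (hf : DifferentiableAt ℝ f w)
    (i : Fin m) : wirtingerBar i (fun z => conj (f z)) w = conj (wirtinger i f w) := by
  have : HasFDerivAt (fun z => conj (f z)) (Complex.conjCLE.toContinuousLinearMap ∘L fderiv ℝ f w) w :=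
    Complex.conjCLE.toContinuousLinearMap.hasFDerivAt.comp w hf.hasFDerivAt
  rw [wirtingerBar, this.fderiv, wirtinger]
  simp [Complex.conj_ofNat]

theorem wirtinger_conj {f : (Fin m → ℂ) → ℂ} {w : Fin m → ℂ} (hf : DifferentiableAt ℝ f w)
    (i : Fin m) : wirtinger i (fun z => conj (f z)) w = conj (wirtingerBar i f w) := by
  have : HasFDerivAt (fun z => conj (f z)) (Complex.conjCLE.toContinuousLinearMap ∘L fderiv ℝ f w) w :=
    Complex.conjCLE.toContinuousLinearMap.hasFDerivAt.comp w hf.hasFDerivAt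
  rw [wirtinger, this.fderiv, wirtingerBar]
  simp [Complex.conj_ofNat, sub_eq_add_neg]

theorem ContDiffOn.fderiv_real_apply {n k : ℕ∞ω} {f : (Fin m → ℂ) → ℂ} {U : Set (Fin m → ℂ)}
    (hU : IsOpen U) (hf : ContDiffOn ℝ n f U) (hk : k + 1 ≤ n) (v : Fin m → ℂ) :
    ContDiffOn ℝ k (fun z => fderiv ℝ f z v) U :=
  (hf.fderiv_of_isOpen hU hk).clm_apply contDiffOn_const

theorem ContDiffOn.wirtinger {n k : ℕ∞ω} {f : (Fin m → ℂ) → ℂ} {U : Set (Fin m → ℂ)}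
    (hU : IsOpen U) (hf : ContDiffOn ℝ n f U) (hk : k + 1 ≤ n) (i : Fin m) :
    ContDiffOn ℝ k (_root_.wirtinger i f) U :=
  contDiffOn_const.mul ((hf.fderiv_real_apply hU hk _).sub
    (contDiffOn_const.mul (hf.fderiv_real_apply hU hk _)))

theorem ContDiffOn.wirtingerBar {n k : ℕ∞ω} {f : (Fin m → ℂ) → ℂ} {U : Set (Fin m → ℂ)}
    (hU : IsOpen U) (hf : ContDiffOn ℝ n f U) (hk : k + 1 ≤ n) (i : Fin m) :
    ContDiffOn ℝ k (_root_.wirtingerBar i f) U :=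
  contDiffOn_const.mul ((hf.fderiv_real_apply hU hk _).add
    (contDiffOn_const.mul (hf.fderiv_real_apply hU hk _)))

section SecondOrder

variable {f : (Fin m → ℂ) → ℂ} {w : Fin m → ℂ}

/-- Expressing second Wirtinger derivatives through the real second derivative reduces their
commutation to its symmetry. -/
theorem fderiv_wirtinger_apply (hf : ContDiffAt ℝ 2 f w) (i : Fin m) (v : Fin m → ℂ) :
    fderiv ℝ (wirtinger i f) w v = (1 / 2 : ℂ) * (fderiv ℝ (fderiv ℝ f) w v (Pi.single i 1)
      - Complex.I * fderiv ℝ (fderiv ℝ f) w v (Pi.single i Complex.I)) := by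
  have hd : DifferentiableAt ℝ (fderiv ℝ f) w :=
    (hf.fderiv_right (m := 1) le_rfl).differentiableAt one_ne_zero
  have h (u : Fin m → ℂ) := hd.hasFDerivAt.clm_apply (hasFDerivAt_const u w)
  have := (((h (Pi.single i 1)).sub ((h (Pi.single i Complex.I)).const_mul Complex.I)).const_mul
    (1 / 2 : ℂ))
  have e : fderiv ℝ (wirtinger i f) w = _ := this.fderiv
  rw [e]
  simp

theorem fderiv_wirtingerBar_apply (hf : ContDiffAt ℝ 2 f w) (i : Fin m) (v : Fin m → ℂ) :
    fderiv ℝ (wirtingerBar i f) w v = (1 / 2 : ℂ) * (fderiv ℝ (fderiv ℝ f) w v (Pi.single i 1)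
      + Complex.I * fderiv ℝ (fderiv ℝ f) w v (Pi.single i Complex.I)) := by
  have hd : DifferentiableAt ℝ (fderiv ℝ f) w :=
    (hf.fderiv_right (m := 1) le_rfl).differentiableAt one_ne_zero
  have h (u : Fin m → ℂ) := hd.hasFDerivAt.clm_apply (hasFDerivAt_const u w)
  have := (((h (Pi.single i 1)).add ((h (Pi.single i Complex.I)).const_mul Complex.I)).const_mul
    (1 / 2 : ℂ))
  have e : fderiv ℝ (wirtingerBar i f) w = _ := this.fderiv
  rw [e]
  simp [mul_add]

theorem wirtinger_comm (hf : ContDiffAt ℝ 2 f w) (i k : Fin m) :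
    wirtinger i (wirtinger k f) w = wirtinger k (wirtinger i f) w := by
  have hs := hf.isSymmSndFDerivAt (by simp)
  rw [wirtinger, wirtinger]
  simp only [fderiv_wirtinger_apply hf]
  rw [hs (Pi.single i 1) (Pi.single k 1), hs (Pi.single i 1) (Pi.single k Complex.I),
    hs (Pi.single i Complex.I) (Pi.single k 1), hs (Pi.single i Complex.I) (Pi.single k Complex.I)]
  ring

theorem wirtinger_wirtingerBar_comm (hf : ContDiffAt ℝ 2 f w) (i k : Fin m) :
    wirtinger i (wirtingerBar k f) w = wirtingerBar k (wirtinger i f) w := by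
  have hs := hf.isSymmSndFDerivAt (by simp)
  rw [wirtinger, wirtingerBar]
  simp only [fderiv_wirtinger_apply hf, fderiv_wirtingerBar_apply hf]
  rw [hs (Pi.single i 1) (Pi.single k 1), hs (Pi.single i 1) (Pi.single k Complex.I),
    hs (Pi.single i Complex.I) (Pi.single k 1), hs (Pi.single i Complex.I) (Pi.single k Complex.I)]
  ring

end SecondOrder

/-- A holomorphic closed `1`-form `∑ gᵢ dzᵢ` on a convex open set has a holomorphic primitive. -/
theorem exists_holomorphic_primitive {H : Type*} [NormedAddCommGroup H] [NormedSpace ℂ H]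
    [CompleteSpace H] {B : Set (Fin m → ℂ)} (hBo : IsOpen B) (hB : Convex ℝ B)
    {g : Fin m → (Fin m → ℂ) → H} (hg : ∀ i, DifferentiableOn ℂ (g i) B)
    (hclosed : ∀ z ∈ B, ∀ i k,
      fderiv ℂ (g i) z (Pi.single k 1) = fderiv ℂ (g k) z (Pi.single i 1)) :
    ∃ f : (Fin m → ℂ) → H, ∀ z ∈ B, HasFDerivAt f
      (∑ i, (ContinuousLinearMap.proj i : (Fin m → ℂ) →L[ℂ] ℂ).smulRight (g i z)) z := by
  set η : (Fin m → ℂ) → ((Fin m → ℂ) →L[ℂ] H) := fun z =>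
    ∑ i, (ContinuousLinearMap.proj i : (Fin m → ℂ) →L[ℂ] ℂ).smulRight (g i z) with hη
  have hηd : ∀ z ∈ B, HasFDerivAt η (∑ i,
      (ContinuousLinearMap.smulRightL ℂ (Fin m → ℂ) H (ContinuousLinearMap.proj i)) ∘L
        fderiv ℂ (g i) z) z := by
    intro z hz
    refine HasFDerivAt.fun_sum fun i _ => ?_
    exact (ContinuousLinearMap.smulRightL ℂ (Fin m → ℂ) H
      (ContinuousLinearMap.proj i)).hasFDerivAt.comp z
        ((hg i).differentiableAt (hBo.mem_nhds hz)).hasFDerivAt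
  -- Poincaré lemma: closedness is symmetry of the real derivative of `η`, and the values of `η` are
  -- already complex linear.
  refine hB.exists_forall_hasFDerivAt_of_fderiv_symmetric hBo
    (fun z hz => ((hηd z hz).restrictScalars ℝ).differentiableAt.differentiableWithinAt)
    fun z hz x y => ?_
  rw [((hηd z hz).restrictScalars ℝ).fderiv]
  have hexp : ∀ (i) (v : Fin m → ℂ), fderiv ℂ (g i) z v
      = ∑ k, v k • fderiv ℂ (g i) z (Pi.single k 1) := fun i v => by
    conv_lhs => rw [pi_eq_sum_univ' v]
    simp
  simp only [ContinuousLinearMap.coe_restrictScalars', sum_apply,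
    ContinuousLinearMap.comp_apply, ContinuousLinearMap.smulRightL_apply_apply,
    ContinuousLinearMap.smulRight_apply, ContinuousLinearMap.proj_apply]
  simp only [hexp _ x, hexp _ y, Finset.smul_sum]
  rw [Finset.sum_comm]
  refine Finset.sum_congr rfl fun i _ => Finset.sum_congr rfl fun k _ => ?_
  rw [hclosed z hz k i, smul_comm]

/-- A real pluriharmonic function on a convex open set is the real part of a holomorphic
function. -/
theorem exists_holomorphic_add_conj_eq {B : Set (Fin m → ℂ)} (hBo : IsOpen B) (hB : Convex ℝ B)
    {u : (Fin m → ℂ) → ℂ} (hu : ContDiffOn ℝ 2 u B) (hreal : ∀ w ∈ B, (u w).im = 0)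
    (hph : ∀ w ∈ B, ∀ i j, wirtinger i (wirtingerBar j u) w = 0) :
    ∃ φ : (Fin m → ℂ) → ℂ, DifferentiableOn ℂ φ B ∧ ∀ w ∈ B, u w = φ w + conj (φ w) := by
  have hat : ∀ w ∈ B, ContDiffAt ℝ 2 u w := fun w hw => hu.contDiffAt (hBo.mem_nhds hw)
  have hud : ∀ w ∈ B, DifferentiableAt ℝ u w := fun w hw => (hat w hw).differentiableAt (by simp)
  -- Pluriharmonicity makes `∂ᵢu` holomorphic, so `∂u` is a closed holomorphic form; its primitive
  -- is `φ` up to a constant.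
  have hg : ∀ i, DifferentiableOn ℂ (wirtinger i u) B := by
    intro i w hw
    refine (differentiableAt_of_wirtingerBar_eq_zero ?_ fun j => ?_).differentiableWithinAt
    · exact ((hu.wirtinger hBo (k := 1) le_rfl i).contDiffAt (hBo.mem_nhds hw)).differentiableAt
        one_ne_zero
    · rw [← wirtinger_wirtingerBar_comm (hat w hw), hph w hw]
  obtain ⟨φ, hφ⟩ := exists_holomorphic_primitive hBo hB hg fun z hz i k => by
    rw [← wirtinger_eq_fderiv ((hg i).differentiableAt (hBo.mem_nhds hz)),
      ← wirtinger_eq_fderiv ((hg k).differentiableAt (hBo.mem_nhds hz)), wirtinger_comm (hat z hz)]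
  have hφd : ∀ w ∈ B, DifferentiableAt ℂ φ w := fun w hw => (hφ w hw).differentiableAt
  have hφr : ∀ w ∈ B, DifferentiableAt ℝ φ w := fun w hw => (hφd w hw).restrictScalars ℝ
  have hφw : ∀ w ∈ B, ∀ i, wirtinger i φ w = wirtinger i u w := by
    intro w hw i
    rw [wirtinger_eq_fderiv (hφd w hw), (hφ w hw).fderiv]
    simp [Pi.single_apply]
  have hconj : ∀ w ∈ B, DifferentiableAt ℝ (fun z => conj (φ z)) w := fun w hw =>
    Complex.conjCLE.differentiableAt.comp w (hφr w hw)
  have hubar : ∀ w ∈ B, ∀ i, wirtingerBar i u w = conj (wirtinger i u w) := by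
    intro w hw i
    rw [← wirtingerBar_conj (hud w hw)]
    refine wirtingerBar_congr ?_ i
    filter_upwards [hBo.mem_nhds hw] with z hz
    exact (Complex.conj_eq_iff_im.mpr (hreal z hz)).symm
  have hsum : ∀ w ∈ B, DifferentiableAt ℝ (fun z => φ z + conj (φ z)) w := fun w hw =>
    (hφr w hw).add (hconj w hw)
  -- The `∂` parts agree by the choice of `φ`, and the `∂̄` parts are their conjugates because `u`
  -- is real.
  have hzero : ∀ w ∈ B, fderivWithin ℝ (fun z => u z - (φ z + conj (φ z))) B w = 0 := by
    intro w hw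
    rw [fderivWithin_of_isOpen hBo hw]
    ext v
    rw [fderiv_eq_sum_wirtinger]
    refine Finset.sum_eq_zero fun i _ => ?_
    rw [wirtinger_sub (hud w hw) (hsum w hw), wirtingerBar_sub (hud w hw) (hsum w hw),
      wirtinger_add (hφr w hw) (hconj w hw), wirtingerBar_add (hφr w hw) (hconj w hw),
      wirtinger_conj (hφr w hw), wirtingerBar_conj (hφr w hw), wirtingerBar_eq_zero (hφd w hw),
      hφw w hw, hubar w hw]
    simp
  rcases B.eq_empty_or_nonempty with rfl | ⟨c, hc⟩
  · exact ⟨0, by simp, by simp⟩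
  set a : ℂ := u c - (φ c + conj (φ c)) with ha
  have hconst : ∀ w ∈ B, u w - (φ w + conj (φ w)) = a := fun w hw =>
    hB.is_const_of_fderivWithin_eq_zero (𝕜 := ℝ)
      (fun w hw => ((hud w hw).sub (hsum w hw)).differentiableWithinAt) hzero hw hc
  have hareal : conj a = a := by
    rw [Complex.conj_eq_iff_im, ha, Complex.sub_im, hreal c hc]
    simp
  -- The leftover constant `a` is real, so half of it goes into `φ` and half into its conjugate.
  refine ⟨fun z => φ z + a / 2, fun w hw =>
    ((hφd w hw).add_const _).differentiableWithinAt, fun w hw => ?_⟩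
  have := hconst w hw
  simp only [map_add, map_div₀, hareal, map_ofNat]
  linear_combination this

end Wirtinger

/-! ### The local model of a line bundle with negative definite curvature -/

section LocalModel

open Metric Filter Set
open scoped Topology ComplexConjugate

theorem Matrix.PosSemidef.of_hasSum {ι : Type*} {X : Type*} [Finite X] {A : ι → Matrix X X ℂ}
    {M : Matrix X X ℂ} (hA : ∀ k, (A k).PosSemidef) (h : ∀ i j, HasSum (fun k => A k i j) (M i j)) :
    M.PosSemidef := by
  have := Fintype.ofFinite X
  refine Matrix.PosSemidef.of_dotProduct_mulVec_nonneg ?_ fun x => ?_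
  · ext i j
    refine HasSum.unique ?_ (h i j)
    exact (h j i).star.congr_fun fun k => (hA k).isHermitian.apply i j |>.symm
  · have hs : HasSum (fun k => star x ⬝ᵥ Matrix.mulVec (A k) x) (star x ⬝ᵥ Matrix.mulVec M x) := by
      simp only [dotProduct, Matrix.mulVec]
      exact hasSum_sum fun i _ => (hasSum_sum fun j _ => (h i j).mul_right _).mul_left _
    exact hs.nonneg fun k => (hA k).dotProduct_mulVec_nonneg x

/-- Iterated Schur product theorem, starting from the all-ones matrix, which has rank one. -/
theorem Matrix.PosSemidef.map_pow {X : Type*} [Finite X] {M : Matrix X X ℂ} (hM : M.PosSemidef)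
    (k : ℕ) : (M.map (· ^ k)).PosSemidef := by
  induction k with
  | zero =>
    have := Fintype.ofFinite X
    have e : M.map (· ^ 0) = Matrix.vecMulVec (1 : X → ℂ) (star 1) := by
      ext i j; simp [Matrix.vecMulVec_apply]
    rw [e]
    exact Matrix.posSemidef_vecMulVec_self_star _
  | succ k ih =>
    have e : M.map (· ^ (k + 1)) = (M.map (· ^ k)).hadamard M := by
      ext i j; simp [pow_succ]
    rw [e]
    exact ih.hadamard hM

/-- The entrywise exponential of a positive definite kernel is positive definite. -/
theorem IsPositiveDefiniteKernel.cexp {X : Type*} {K : X → X → ℂ}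
    (hK : IsPositiveDefiniteKernel K) :
    IsPositiveDefiniteKernel fun x y => Complex.exp (K x y) := by
  intro n x
  -- The exponential series has nonnegative coefficients `1 / k!`.
  refine Matrix.PosSemidef.of_hasSum (ι := ℕ)
    (A := fun k => ((k.factorial : ℝ)⁻¹) • (Matrix.of fun i j => K (x i) (x j)).map (· ^ k))
    (fun k => ((hK n x).map_pow k).smul (by positivity)) fun i j => ?_
  have := NormedSpace.expSeries_div_hasSum_exp (𝔸 := ℂ) (K (x i) (x j))
  rw [← Complex.exp_eq_exp_ℂ] at this
  simpa [div_eq_inv_mul] using this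

theorem IsPositiveDefiniteKernel.const_mul {X : Type*} {K : X → X → ℂ}
    (hK : IsPositiveDefiniteKernel K) {t : ℝ} (ht : 0 ≤ t) :
    IsPositiveDefiniteKernel fun x y => (t : ℂ) * K x y := by
  intro n x
  convert (hK n x).smul ht using 1
  ext i j
  simp

theorem isPositiveDefiniteKernel_inner {X H : Type*} [NormedAddCommGroup H]
    [InnerProductSpace ℂ H] (Φ : X → H) :
    IsPositiveDefiniteKernel fun z w => inner ℂ (Φ w) (Φ z) := fun _ x =>
  (Matrix.posSemidef_gram ℂ fun i => Φ (x i)).transpose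

variable {m : ℕ}

theorem isOpen_polarized {U : Set (Fin m → ℂ)} (hU : IsOpen U) :
    IsOpen {p : (Fin m → ℂ) × (Fin m → ℂ) | p.1 ∈ U ∧ star p.2 ∈ U} :=
  (hU.preimage continuous_fst).inter (hU.preimage (continuous_star.comp continuous_snd))

theorem star_single_one (k : Fin m) : star (Pi.single k 1 : Fin m → ℂ) = Pi.single k 1 := by
  ext i
  rcases eq_or_ne i k with rfl | h
  · simp
  · simp [h]

/-- The second argument `star z` is antiholomorphic, so `∂ₖ` sees only the first one. Thus
derivatives of a polarization can be compared with those of its diagonal. -/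
theorem wirtinger_diagonal {U : Set (Fin m → ℂ)} (hU : IsOpen U)
    {Γ : (Fin m → ℂ) × (Fin m → ℂ) → ℂ}
    (hΓ : DifferentiableOn ℂ Γ {p | p.1 ∈ U ∧ star p.2 ∈ U}) {w : Fin m → ℂ} (hw : w ∈ U)
    (k : Fin m) :
    wirtinger k (fun z => Γ (z, star z)) w = fderiv ℂ Γ (w, star w) (Pi.single k 1, 0) := by
  have hd : DifferentiableAt ℂ Γ (w, star w) :=
    hΓ.differentiableAt ((isOpen_polarized hU).mem_nhds ⟨hw, by simpa using hw⟩)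
  have h1 := (hd.hasFDerivAt.restrictScalars ℝ).comp (f := fun z => (z, star z)) w
    ((hasFDerivAt_id w).prodMk (hasFDerivAt_id w).star)
  have h2 : fderiv ℝ (fun z => Γ (z, star z)) w = _ := h1.fderiv
  set e : Fin m → ℂ := Pi.single k 1
  have hstar : star (Complex.I • e) = -(Complex.I • e) := by
    rw [star_smul, star_single_one, Complex.star_def, Complex.conj_I, neg_smul]
  have h3 : ∀ v : Fin m → ℂ, fderiv ℝ (fun z => Γ (z, star z)) w v
      = fderiv ℂ Γ (w, star w) (v, star v) := fun v => by rw [h2]; rfl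
  have h4 : ((e, star e) : (Fin m → ℂ) × (Fin m → ℂ)) = (e, 0) + (0, e) := by
    rw [star_single_one, Prod.mk_add_mk, add_zero, zero_add]
  have h5 : ((Complex.I • e, star (Complex.I • e)) : (Fin m → ℂ) × (Fin m → ℂ))
      = Complex.I • (e, 0) - Complex.I • (0, e) := by
    rw [hstar]; simp
  rw [wirtinger, single_I_eq_smul, h3, h3, h4, h5, map_add, map_sub, map_smul, map_smul,
    smul_eq_mul, smul_eq_mul]
  linear_combination (-(1 / 2) * fderiv ℂ Γ (w, star w) (e, 0)
    + 1 / 2 * fderiv ℂ Γ (w, star w) (0, e)) * Complex.I_sq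

/-- Conjugate-linearity of `inner` in its first slot cancels against `star`, leaving a complex
linear derivative, which is written out in coordinates. -/
theorem differentiableAt_inner_star {H : Type*} [NormedAddCommGroup H] [InnerProductSpace ℂ H]
    {Φ : (Fin m → ℂ) → H} {p : (Fin m → ℂ) × (Fin m → ℂ)} (h₁ : DifferentiableAt ℂ Φ p.1)
    (h₂ : DifferentiableAt ℂ Φ (star p.2)) :
    DifferentiableAt ℂ (fun p : (Fin m → ℂ) × (Fin m → ℂ) => inner ℂ (Φ (star p.2)) (Φ p.1)) p := by
  let : InnerProductSpace ℝ H := InnerProductSpace.rclikeToReal ℂ H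
  have hr₁ : HasFDerivAt (fun q : (Fin m → ℂ) × (Fin m → ℂ) => Φ q.1) _ p :=
    (h₁.hasFDerivAt.restrictScalars ℝ).comp p hasFDerivAt_fst
  have hr₂ : HasFDerivAt (fun q : (Fin m → ℂ) × (Fin m → ℂ) => Φ (star q.2)) _ p :=
    (h₂.hasFDerivAt.restrictScalars ℝ).comp (f := fun q : (Fin m → ℂ) × (Fin m → ℂ) => star q.2) p
      hasFDerivAt_snd.star
  refine (hasFDerivAt_of_restrictScalars ℝ (hr₂.inner ℂ hr₁) (f' :=
    (innerSL ℂ (Φ (star p.2))) ∘L fderiv ℂ Φ p.1 ∘L ContinuousLinearMap.fst ℂ _ _ +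
    ∑ i, inner ℂ (fderiv ℂ Φ (star p.2) (Pi.single i 1)) (Φ p.1) •
      ((ContinuousLinearMap.proj i : (Fin m → ℂ) →L[ℂ] ℂ) ∘L ContinuousLinearMap.snd ℂ _ _))
    ?_).differentiableAt
  refine ContinuousLinearMap.ext fun v => ?_
  have hv : fderiv ℂ Φ (star p.2) (star v.2)
      = ∑ i, conj (v.2 i) • fderiv ℂ Φ (star p.2) (Pi.single i 1) := by
    conv_lhs => rw [pi_eq_sum_univ' (star v.2)]
    simp
  have e : inner ℂ (fderiv ℂ Φ (star p.2) (star v.2)) (Φ p.1)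
      = ∑ i, inner ℂ (fderiv ℂ Φ (star p.2) (Pi.single i 1)) (Φ p.1) * v.2 i := by
    rw [hv, sum_inner]
    simp [inner_smul_left, mul_comm]
  simp [e]

/-- The dependence through `Ψ` is antiholomorphic, so `∂ᵢ` differentiates only `Φ`. -/
theorem wirtinger_inner {H : Type*} [NormedAddCommGroup H] [InnerProductSpace ℂ H]
    {Φ Ψ : (Fin m → ℂ) → H} {w : Fin m → ℂ} (hΦ : DifferentiableAt ℂ Φ w)
    (hΨ : DifferentiableAt ℂ Ψ w) (i : Fin m) :
    wirtinger i (fun z => inner ℂ (Ψ z) (Φ z)) w = inner ℂ (Ψ w) (fderiv ℂ Φ w (Pi.single i 1)) := by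
  let : InnerProductSpace ℝ H := InnerProductSpace.rclikeToReal ℂ H
  rw [wirtinger, fderiv_inner_apply ℂ (hΨ.restrictScalars ℝ) (hΦ.restrictScalars ℝ),
    fderiv_inner_apply ℂ (hΨ.restrictScalars ℝ) (hΦ.restrictScalars ℝ),
    (hΦ.hasFDerivAt.restrictScalars ℝ).fderiv, (hΨ.hasFDerivAt.restrictScalars ℝ).fderiv,
    single_I_eq_smul]
  simp only [ContinuousLinearMap.coe_restrictScalars', map_smul, inner_smul_left, inner_smul_right,
    Complex.conj_I]
  linear_combination (1 / 2 * inner ℂ (fderiv ℂ Ψ w (Pi.single i 1)) (Φ w)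
    - 1 / 2 * inner ℂ (Ψ w) (fderiv ℂ Φ w (Pi.single i 1))) * Complex.I_sq

theorem wirtingerBar_inner {H : Type*} [NormedAddCommGroup H] [InnerProductSpace ℂ H]
    {Φ Ψ : (Fin m → ℂ) → H} {w : Fin m → ℂ} (hΦ : DifferentiableAt ℂ Φ w)
    (hΨ : DifferentiableAt ℂ Ψ w) (j : Fin m) :
    wirtingerBar j (fun z => inner ℂ (Ψ z) (Φ z)) w
      = inner ℂ (fderiv ℂ Ψ w (Pi.single j 1)) (Φ w) := by
  let : InnerProductSpace ℝ H := InnerProductSpace.rclikeToReal ℂ H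
  rw [wirtingerBar, fderiv_inner_apply ℂ (hΨ.restrictScalars ℝ) (hΦ.restrictScalars ℝ),
    fderiv_inner_apply ℂ (hΨ.restrictScalars ℝ) (hΦ.restrictScalars ℝ),
    (hΦ.hasFDerivAt.restrictScalars ℝ).fderiv, (hΨ.hasFDerivAt.restrictScalars ℝ).fderiv,
    single_I_eq_smul]
  simp only [ContinuousLinearMap.coe_restrictScalars', map_smul, inner_smul_left, inner_smul_right,
    Complex.conj_I]
  linear_combination (1 / 2 * inner ℂ (Ψ w) (fderiv ℂ Φ w (Pi.single j 1))
    - 1 / 2 * inner ℂ (fderiv ℂ Ψ w (Pi.single j 1)) (Φ w)) * Complex.I_sq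

/-- The Gram vectors of the polarization of `∂∂̄ h` form a closed holomorphic `1`-form, and
`h` is the squared norm of its primitive up to a pluriharmonic function. -/
theorem exists_holomorphic_normSq_add {B : Set (Fin m → ℂ)} (hBo : IsOpen B) (hB : Convex ℝ B)
    {h : (Fin m → ℂ) → ℂ} (hsm : ContDiffOn ℝ ∞ h B) (hreal : ∀ w ∈ B, (h w).im = 0)
    {G : (Fin m → ℂ) → (Fin m → ℂ) → Matrix (Fin m) (Fin m) ℂ}
    (hG : ∀ i j, DifferentiableOn ℂ (fun p : (Fin m → ℂ) × (Fin m → ℂ) => G p.1 (star p.2) i j)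
      {p | p.1 ∈ B ∧ star p.2 ∈ B})
    (hdiag : ∀ w ∈ B, ∀ i j, wirtinger i (wirtingerBar j h) w = G w w i j)
    (hpos : IsPositiveDefiniteMatrixKernel fun z w : B => G z w) :
    ∃ (H : Type) (_ : NormedAddCommGroup H) (_ : InnerProductSpace ℂ H) (Φ : (Fin m → ℂ) → H)
      (φ : (Fin m → ℂ) → ℂ), DifferentiableOn ℂ Φ B ∧ DifferentiableOn ℂ φ B ∧
        ∀ w ∈ B, h w = inner ℂ (Φ w) (Φ w) + (φ w + conj (φ w)) := by
  have hpos' : (Matrix.of fun a b : B × Fin m => G a.1 b.1 a.2 b.2).PosSemidef :=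
    Matrix.PosSemidef.of_submatrix_fin fun n x =>
      -- The block matrix carries every index at each chosen point; keep only the index prescribed
      -- at that point.
      (hpos n fun p => (x p).1).submatrix fun p => (p, (x p).2)
  obtain ⟨H, _, _, _, _, Ψ, hΨd, hΨ, htot⟩ := exists_holomorphic_feature_map hBo
    (fun i j z w => G z w i j) hG hpos'
  have hΨat : ∀ i, ∀ z ∈ B, DifferentiableAt ℂ (Ψ i) z := fun i z hz =>
    (hΨd i).differentiableAt (hBo.mem_nhds hz)
  have hΓat : ∀ i j, ∀ z ∈ B, ∀ w ∈ B, DifferentiableAt ℂ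
      (fun p : (Fin m → ℂ) × (Fin m → ℂ) => G p.1 (star p.2) i j) (z, star w) :=
    fun i j z hz w hw => (hG i j).differentiableAt
      ((isOpen_polarized hBo).mem_nhds ⟨hz, by simpa using hw⟩)
  have hpartial : ∀ i j k, ∀ z ∈ B, ∀ w ∈ B,
      inner ℂ (Ψ j w) (fderiv ℂ (Ψ i) z (Pi.single k 1)) =
        fderiv ℂ (fun p : (Fin m → ℂ) × (Fin m → ℂ) => G p.1 (star p.2) i j) (z, star w)
          (Pi.single k 1, 0) := by
    intro i j k z hz w hw
    have h1 := (innerSL ℂ (Ψ j w)).hasFDerivAt.comp z (hΨat i z hz).hasFDerivAt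
    have h2 := (hΓat i j z hz w hw).hasFDerivAt.comp (f := fun y => (y, star w)) z
      ((hasFDerivAt_id z).prodMk (hasFDerivAt_const (star w) z))
    have h3 := h2.congr_of_eventuallyEq (f₁ := innerSL ℂ (Ψ j w) ∘ Ψ i) (by
      filter_upwards [hBo.mem_nhds hz] with y hy
      simp [hΨ i j y hy w hw])
    have := congrArg (fun L : (Fin m → ℂ) →L[ℂ] ℂ => L (Pi.single k 1)) (h1.unique h3)
    simpa using this
  have hbar : ∀ j, ContDiffOn ℝ 2 (wirtingerBar j h) B := fun j =>
    hsm.wirtingerBar hBo (k := 2) (WithTop.coe_le_coe.mpr (le_top (a := (2 + 1 : ℕ∞)))) j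
  have hclosed : ∀ z ∈ B, ∀ i k,
      fderiv ℂ (Ψ i) z (Pi.single k 1) = fderiv ℂ (Ψ k) z (Pi.single i 1) := by
    intro z hz i k
    rw [← sub_eq_zero]
    refine htot _ fun j w hw => ?_
    rw [inner_sub_right, hpartial i j k z hz w hw, hpartial k j i z hz w hw]
    -- Closedness, tested against the total family `Ψ j w`, has become an identity between polarized
    -- functions, so the diagonal suffices. There both terms are third derivatives of `h`, symmetric
    -- in `i` and `k`.
    refine eq_zero_of_diagonal_eq_zero hBo hB (f := fun p =>
      fderiv ℂ (fun p : (Fin m → ℂ) × (Fin m → ℂ) => G p.1 (star p.2) i j) p (Pi.single k 1, 0) -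
      fderiv ℂ (fun p : (Fin m → ℂ) × (Fin m → ℂ) => G p.1 (star p.2) k j) p (Pi.single i 1, 0))
      (((hG i j).fderiv_apply (isOpen_polarized hBo) _).sub
        ((hG k j).fderiv_apply (isOpen_polarized hBo) _)) (fun y hy => ?_) hz hw
    have key : ∀ i k, fderiv ℂ (fun p : (Fin m → ℂ) × (Fin m → ℂ) => G p.1 (star p.2) i j)
        (y, star y) (Pi.single k 1, 0) = wirtinger k (wirtinger i (wirtingerBar j h)) y := by
      intro i k
      rw [← wirtinger_diagonal hBo (hG i j) hy]
      refine wirtinger_congr ?_ k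
      filter_upwards [hBo.mem_nhds hy] with x hx
      rw [hdiag x hx, star_star]
    simp only [key]
    rw [wirtinger_comm ((hbar j).contDiffAt (hBo.mem_nhds hy)), sub_self]
  obtain ⟨Φ, hΦ⟩ := exists_holomorphic_primitive hBo hB hΨd hclosed
  have hΦat : ∀ z ∈ B, DifferentiableAt ℂ Φ z := fun z hz => (hΦ z hz).differentiableAt
  have hΦd : DifferentiableOn ℂ Φ B := fun z hz => (hΦat z hz).differentiableWithinAt
  have hΦi : ∀ z ∈ B, ∀ i, fderiv ℂ Φ z (Pi.single i 1) = Ψ i z := by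
    intro z hz i
    rw [(hΦ z hz).fderiv]
    simp [Pi.single_apply, ite_smul]
  have hsq : ContDiffOn ℝ 2 (fun z => inner ℂ (Φ z) (Φ z)) B := by
    let : InnerProductSpace ℝ H := InnerProductSpace.rclikeToReal ℂ H
    have : ContDiffOn ℝ 2 Φ B :=
      ((hΦd.contDiffOn_of_finiteDimensional hBo).of_le ENat.LEInfty.out).restrict_scalars ℝ
    exact this.inner ℂ this
  have hsm2 : ContDiffOn ℝ 2 h B := hsm.of_le ENat.LEInfty.out
  -- Since `∂ᵢΦ = Ψᵢ`, the complex Hessian of `‖Φ‖²` is the Gram matrix of the `Ψᵢ`, which equals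
  -- that of `h`.
  obtain ⟨φ, hφd, hφ⟩ := exists_holomorphic_add_conj_eq hBo hB
    (u := fun z => h z - inner ℂ (Φ z) (Φ z)) (hsm2.sub hsq)
    (fun w hw => by
      rw [Complex.sub_im, hreal w hw]
      simpa using inner_self_im (𝕜 := ℂ) (Φ w))
    (fun w hw i j => by
      have h1 : wirtingerBar j (fun z => h z - inner ℂ (Φ z) (Φ z)) =ᶠ[𝓝 w]
          fun z => wirtingerBar j h z - inner ℂ (Ψ j z) (Φ z) := by
        filter_upwards [hBo.mem_nhds hw] with z hz
        rw [wirtingerBar_sub ((hsm2.contDiffAt (hBo.mem_nhds hz)).differentiableAt (by simp))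
          ((hsq.contDiffAt (hBo.mem_nhds hz)).differentiableAt (by simp)),
          wirtingerBar_inner (hΦat z hz) (hΦat z hz), hΦi z hz]
      have h2 : DifferentiableAt ℝ (fun z => inner ℂ (Ψ j z) (Φ z)) w := by
        let : InnerProductSpace ℝ H := InnerProductSpace.rclikeToReal ℂ H
        exact ((hΨat j w hw).restrictScalars ℝ).inner ℂ ((hΦat w hw).restrictScalars ℝ)
      rw [wirtinger_congr h1, wirtinger_sub
        (((hbar j).contDiffAt (hBo.mem_nhds hw)).differentiableAt (by simp)) h2,
        wirtinger_inner (hΦat w hw) (hΨat j w hw), hΦi w hw, hΨ i j w hw w hw, hdiag w hw, sub_self])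
  exact ⟨H, _, _, Φ, φ, hΦd, hφd, fun w hw => by rw [← hφ w hw]; ring⟩

/-- The local model: `h` is, up to the real part of a holomorphic function, the logarithm of
`‖γ‖²` for a holomorphic Hilbert space valued map `γ` with infinitely divisible Gram kernel. -/
theorem exists_local_model {B : Set (Fin m → ℂ)} (hBo : IsOpen B) (hB : Convex ℝ B)
    {h : (Fin m → ℂ) → ℂ} (hsm : ContDiffOn ℝ ∞ h B) (hreal : ∀ w ∈ B, (h w).im = 0)
    {G : (Fin m → ℂ) → (Fin m → ℂ) → Matrix (Fin m) (Fin m) ℂ}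
    (hG : ∀ i j, DifferentiableOn ℂ (fun p : (Fin m → ℂ) × (Fin m → ℂ) => G p.1 (star p.2) i j)
      {p | p.1 ∈ B ∧ star p.2 ∈ B})
    (hdiag : ∀ w ∈ B, ∀ i j, wirtinger i (wirtingerBar j h) w = G w w i j)
    (hpos : IsPositiveDefiniteMatrixKernel fun z w : B => G z w) :
    ∃ (H : Type) (_ : NormedAddCommGroup H) (_ : InnerProductSpace ℂ H) (_ : CompleteSpace H)
      (_ : SeparableSpace H) (γ : (Fin m → ℂ) → H) (φ : (Fin m → ℂ) → ℂ),
      DifferentiableOn ℂ γ B ∧ DifferentiableOn ℂ φ B ∧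
      (∀ w ∈ B, ((‖γ w‖ ^ 2 : ℝ) : ℂ) = Complex.exp (h w - (φ w + conj (φ w)))) ∧
      (∀ z ∈ B, ∀ w ∈ B, inner ℂ (γ w) (γ z) ≠ 0) ∧
      IsInfinitelyDivisible fun z w : B => inner ℂ (γ w) (γ z) := by
  obtain ⟨H₁, _, _, Φ, φ, hΦ, hφ, hh⟩ := exists_holomorphic_normSq_add hBo hB hsm hreal hG hdiag hpos
  set L : (Fin m → ℂ) → (Fin m → ℂ) → ℂ := fun z w => inner ℂ (Φ w) (Φ z) with hL
  have hLd : DifferentiableOn ℂ (fun p : (Fin m → ℂ) × (Fin m → ℂ) => L p.1 (star p.2))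
      {p | p.1 ∈ B ∧ star p.2 ∈ B} := fun p hp =>
    (differentiableAt_inner_star (hΦ.differentiableAt (hBo.mem_nhds hp.1))
      (hΦ.differentiableAt (hBo.mem_nhds hp.2))).differentiableWithinAt
  have hpow : ∀ t : ℝ, 0 ≤ t →
      IsPositiveDefiniteKernel fun z w : B => Complex.exp ((t : ℂ) * L z w) := fun t ht =>
    ((isPositiveDefiniteKernel_inner fun z : B => Φ z).const_mul ht).cexp
  have h1 : IsPositiveDefiniteKernel fun z w : B => Complex.exp (L z w) := by
    simpa using hpow 1 zero_le_one
  -- Second Kolmogorov decomposition, for a scalar kernel, hence the one-point index type. As this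
  -- kernel is an exponential, it has no zeros.
  obtain ⟨H, _, _, _, _, γ, hγd, hγ, -⟩ := exists_holomorphic_feature_map (ι := Unit) hBo
    (fun _ _ z w => Complex.exp (L z w)) (fun _ _ => hLd.cexp)
    (h1.posSemidef.submatrix Prod.fst)
  have hγ' : ∀ z ∈ B, ∀ w ∈ B, inner ℂ (γ () w) (γ () z) = Complex.exp (L z w) :=
    fun z hz w hw => hγ () () z hz w hw
  refine ⟨H, _, _, ‹_›, ‹_›, γ (), φ, hγd (), hφ, fun w hw => ?_, fun z hz w hw => ?_, ?_⟩
  · rw [hh w hw, add_sub_cancel_right, ← hγ' w hw w hw, inner_self_eq_norm_sq_to_K]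
    simp
  · rw [hγ' z hz w hw]
    exact Complex.exp_ne_zero _
  · have e : (fun z w : B => inner ℂ (γ () w) (γ () z)) = fun z w : B => Complex.exp (L z w) := by
      ext z w
      exact hγ' z z.2 w w.2
    rw [e]
    refine ⟨h1, fun z w => L z w, ?_, fun x => ?_, fun _ _ => rfl, fun t ht => hpow t ht.le⟩
    · have hc : Continuous fun z : B => Φ z := continuousOn_iff_continuous_domRestrict.mp hΦ.continuousOn
      exact (hc.comp continuous_snd).inner (hc.comp continuous_fst)
    · exact inner_self_im (𝕜 := ℂ) (Φ x)

end LocalModel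

/-! ### Holomorphic frames of line bundles -/

section Frame

open Metric Filter Set
open scoped Topology ComplexConjugate

variable {m : ℕ}

/-- Adding the real part of a holomorphic function does not change the complex Hessian. -/
theorem wirtinger_wirtingerBar_add_re {f ℓ : (Fin m → ℂ) → ℂ} {w : Fin m → ℂ}
    (hf : ContDiffAt ℝ 2 f w) (hℓ : ∀ᶠ z in 𝓝 w, DifferentiableAt ℂ ℓ z) (i j : Fin m) :
    wirtinger i (wirtingerBar j fun z => f z + (ℓ z + conj (ℓ z))) w =
      wirtinger i (wirtingerBar j f) w := by
  obtain ⟨U, hU, hUo, hw⟩ := _root_.eventually_nhds_iff.mp hℓ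
  have hℓd : DifferentiableOn ℂ ℓ U := fun z hz => (hU z hz).differentiableWithinAt
  -- Of the added terms, `∂̄ⱼ` leaves only the conjugate of `∂ⱼℓ`. As `∂ⱼℓ` is holomorphic, `∂ᵢ`
  -- kills that conjugate.
  have hg : DifferentiableAt ℂ (wirtinger j ℓ) w := by
    refine ((hℓd.fderiv_apply hUo (Pi.single j 1)).differentiableAt
      (hUo.mem_nhds hw)).congr_of_eventuallyEq ?_
    filter_upwards [hℓ] with z hz using wirtinger_eq_fderiv hz j
  have hconj : ∀ g : (Fin m → ℂ) → ℂ, ∀ z, DifferentiableAt ℝ g z →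
      DifferentiableAt ℝ (fun z => conj (g z)) z := fun g z hz =>
    Complex.conjCLE.differentiableAt.comp z hz
  have hfd : ∀ᶠ z in 𝓝 w, DifferentiableAt ℝ f z := by
    filter_upwards [hf.eventually (by simp)] with z hz using hz.differentiableAt (by simp)
  have h1 : wirtingerBar j (fun z => f z + (ℓ z + conj (ℓ z))) =ᶠ[𝓝 w]
      fun z => wirtingerBar j f z + conj (wirtinger j ℓ z) := by
    filter_upwards [hℓ, hfd] with z hz hfz
    have hzr : DifferentiableAt ℝ ℓ z := hz.restrictScalars ℝ
    rw [wirtingerBar_add hfz (hzr.fun_add (hconj ℓ z hzr)), wirtingerBar_add hzr (hconj ℓ z hzr),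
      wirtingerBar_eq_zero hz, wirtingerBar_conj hzr, zero_add]
  have h2 : DifferentiableAt ℝ (wirtingerBar j f) w := by
    obtain ⟨V, hV, hVo, hwV⟩ := _root_.eventually_nhds_iff.mp (hf.eventually (by simp))
    have : ContDiffOn ℝ 2 f V := fun z hz => (hV z hz).contDiffWithinAt
    exact ((this.wirtingerBar hVo (k := 1) le_rfl j).contDiffAt
      (hVo.mem_nhds hwV)).differentiableAt one_ne_zero
  have hgr := hg.restrictScalars ℝ
  rw [wirtinger_congr h1, wirtinger_add h2 (hconj _ w hgr), wirtinger_conj hgr,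
    wirtingerBar_eq_zero hg, map_zero, add_zero]

variable {Ω : Opens (Fin m → ℂ)}

theorem contDiffAt_of_contMDiffAt_subtype {F : Type*} [NormedAddCommGroup F] [NormedSpace ℝ F]
    {n : ℕ∞ω} {g : (Fin m → ℂ) → F} {w : Ω}
    (h : ContMDiffAt 𝓘(ℝ, Fin m → ℂ) 𝓘(ℝ, F) n (fun x : Ω => g x) w) : ContDiffAt ℝ n g w :=
  contMDiffAt_iff_contDiffAt.mp (contMDiffAt_subtype_iff.mp h)

theorem contDiffAt_complex_of_contMDiffAt_subtype {F : Type*} [NormedAddCommGroup F]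
    [NormedSpace ℂ F] {n : ℕ∞ω} {g : (Fin m → ℂ) → F} {w : Ω}
    (h : ContMDiffAt 𝓘(ℂ, Fin m → ℂ) 𝓘(ℂ, F) n (fun x : Ω => g x) w) : ContDiffAt ℂ n g w :=
  contMDiffAt_iff_contDiffAt.mp (contMDiffAt_subtype_iff.mp h)

theorem mdifferentiableAt_comp_val_val {H : Type*} [NormedAddCommGroup H] [NormedSpace ℂ H]
    {Ω₀ : Opens Ω} {g : (Fin m → ℂ) → H} {w : Ω₀} (hg : DifferentiableAt ℂ g (w : Ω)) :
    MDifferentiableAt 𝓘(ℂ, Fin m → ℂ) 𝓘(ℂ, H) (fun w : Ω₀ => g (w : Ω)) w := by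
  have h1 : MDifferentiableAt 𝓘(ℂ, Fin m → ℂ) 𝓘(ℂ, Fin m → ℂ)
      (fun w : Ω₀ => ((w : Ω) : Fin m → ℂ)) w :=
    ((contMDiff_subtype_val (n := 1)).comp (contMDiff_subtype_val (n := 1))).mdifferentiable
      one_ne_zero w
  exact (mdifferentiableAt_iff_differentiableAt.mpr hg).comp w h1

variable {E : Ω → Type*} [∀ w, NormedAddCommGroup (E w)] [∀ w, InnerProductSpace ℂ (E w)]
  [TopologicalSpace (TotalSpace ℂ E)] [FiberBundle ℂ E] [VectorBundle ℂ ℂ E]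

omit [∀ w, InnerProductSpace ℂ (E w)] [TopologicalSpace (TotalSpace ℂ E)] [FiberBundle ℂ E]
  [VectorBundle ℂ ℂ E] in
theorem logNormSq_apply (s : ∀ w : Ω, E w) (w : Ω) :
    logNormSq s w = ((Real.log (‖s w‖ ^ 2) : ℝ) : ℂ) := by
  simp [logNormSq]

variable (e : Trivialization ℂ (π ℂ E)) [MemTrivializationAtlas e]

omit [FiberBundle ℂ E] [VectorBundle ℂ ℂ E] [MemTrivializationAtlas e] in
theorem frame_smul [e.IsLinear ℂ] {w : Ω} (hw : w ∈ e.baseSet) (v : E w) :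
    (e ⟨w, v⟩).2 • e.symm w (1 : ℂ) = v := by
  have h := e.symm_apply_apply_mk hw v
  rw [← e.coe_symmₗ (R := ℂ), ← map_smul, smul_eq_mul, mul_one, e.coe_symmₗ, h]
  all_goals exact hw

theorem frame_ne_zero {w : Ω} (hw : w ∈ e.baseSet) : e.symm w (1 : ℂ) ≠ 0 := by
  intro h
  have h1 := e.apply_mk_symm hw (1 : ℂ)
  rw [h] at h1
  have h2 := (e.linearMapAt ℂ w).map_zero
  rw [e.coe_linearMapAt_of_mem hw] at h2
  change (e ⟨w, 0⟩).2 = 0 at h2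
  rw [h1] at h2
  exact one_ne_zero h2

theorem contDiffAt_logNormSq_frame [IsHermitianBundle ℂ E] {w : Ω} (hw : w ∈ e.baseSet) :
    ContDiffAt ℝ ∞ (logNormSq fun z : Ω => e.symm z (1 : ℂ)) w := by
  refine contDiffAt_of_contMDiffAt_subtype ?_
  have h1 := (IsHermitianBundle.smooth_inner e (1 : ℂ) 1).contMDiffAt (e.open_baseSet.mem_nhds hw)
  have h2 : ContDiffAt ℝ ∞ (fun z : ℂ => ((Real.log z.re : ℝ) : ℂ))
      (inner ℂ (e.symm w (1 : ℂ)) (e.symm w (1 : ℂ))) := by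
    refine Complex.ofRealCLM.contDiff.contDiffAt.comp _ ((Complex.reCLM.contDiff.contDiffAt).log ?_)
    have := inner_self_eq_norm_sq (𝕜 := ℂ) (e.symm w (1 : ℂ))
    have h3 := norm_pos_iff.mpr (frame_ne_zero e hw)
    change (inner ℂ (e.symm w (1 : ℂ)) (e.symm w (1 : ℂ))).re ≠ 0
    change (inner ℂ (e.symm w (1 : ℂ)) (e.symm w (1 : ℂ))).re = _ at this
    rw [this]
    positivity
  refine (h2.contMDiffAt.comp w h1).congr_of_eventuallyEq (Eventually.of_forall fun z => ?_)
  change logNormSq (fun z : Ω => e.symm z (1 : ℂ)) z = _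
  rw [logNormSq_apply, ← inner_self_eq_norm_sq (𝕜 := ℂ)]
  rfl

/-- The curvature can be computed in any holomorphic frame. -/
theorem curvatureMatrix_eq_frame [ContMDiffVectorBundle ω ℂ E 𝓘(ℂ, Fin m → ℂ)]
    [IsHermitianBundle ℂ E] {w : Ω} (hw : w ∈ e.baseSet) (i j : Fin m) :
    curvatureMatrix E w i j =
      - wirtinger i (wirtingerBar j (logNormSq fun z : Ω => e.symm z (1 : ℂ))) w := by
  classical
  set e' := trivializationAt ℂ E w
  have hw' : w ∈ e'.baseSet := FiberBundle.mem_baseSet_trivializationAt' w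
  have hmem : ∀ᶠ z : Ω in 𝓝 w, z ∈ e.baseSet ∧ z ∈ e'.baseSet :=
    (e.open_baseSet.inter e'.open_baseSet).mem_nhds ⟨hw, hw'⟩
  -- The transition function between the two frames, with the value `0` off `Ω`.
  set c : (Fin m → ℂ) → ℂ := fun x => if hx : x ∈ Ω then e'.coordChangeL ℂ e ⟨x, hx⟩ 1 else 0
  have hc : ∀ z : Ω, c z = e'.coordChangeL ℂ e z 1 := fun z => by simp [c]
  have hcs : ∀ z : Ω, z ∈ e.baseSet → z ∈ e'.baseSet →
      e'.symm z (1 : ℂ) = c z • e.symm z (1 : ℂ) := by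
    intro z hz hz'
    rw [hc, Trivialization.coordChangeL_apply e' e ⟨hz', hz⟩, frame_smul e hz]
  have hcω : ContDiffAt ℂ ω c w := by
    refine contDiffAt_complex_of_contMDiffAt_subtype ?_
    have h1 : ContMDiffAt 𝓘(ℂ, Fin m → ℂ) 𝓘(ℂ, ℂ →L[ℂ] ℂ) ω
        (fun b : Ω => (e'.coordChangeL ℂ e b : ℂ →L[ℂ] ℂ)) w := contMDiffAt_coordChangeL hw' hw
    have h2 := h1.clm_apply (contMDiffAt_const (c := (1 : ℂ)))
    exact h2.congr_of_eventuallyEq (Eventually.of_forall hc)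
  have hcw : c w ≠ 0 := by
    intro h
    have := hcs w hw hw'
    rw [h, zero_smul] at this
    exact frame_ne_zero e' hw' this
  -- Dividing by `c w` moves the values near `1`, inside the domain of the principal logarithm. The
  -- real constant restores `ℓ + conj ℓ = log |c|²`.
  set ℓ : (Fin m → ℂ) → ℂ := fun x => Complex.log (c x / c w) + (Real.log ‖c w‖ : ℂ)
  have hslit : ∀ᶠ x in 𝓝 (w : Fin m → ℂ), c x / c w ∈ Complex.slitPlane := by
    have h1 : ContinuousAt (fun x => c x / c w) w := hcω.continuousAt.div_const _
    refine h1.eventually_mem (Complex.isOpen_slitPlane.mem_nhds ?_)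
    rw [div_self hcw]
    exact Complex.one_mem_slitPlane
  have hℓd : ∀ᶠ x in 𝓝 (w : Fin m → ℂ), DifferentiableAt ℂ ℓ x := by
    filter_upwards [hslit, (hcω.of_le (m := 1) le_top).eventually (by simp)] with x hx hcx
    have h1 : DifferentiableAt ℂ (fun x => c x / c w) x := by
      simpa only [div_eq_mul_inv] using (hcx.differentiableAt one_ne_zero).mul_const (c w)⁻¹
    exact (h1.clog hx).add_const _
  have hΩw : (Ω : Set (Fin m → ℂ)) ∈ 𝓝 (w : Fin m → ℂ) := Ω.isOpen.mem_nhds w.2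
  have hmem' : ∀ᶠ x in 𝓝 (w : Fin m → ℂ), ∀ hx : x ∈ Ω,
      (⟨x, hx⟩ : Ω) ∈ e.baseSet ∧ (⟨x, hx⟩ : Ω) ∈ e'.baseSet := by
    rw [nhds_subtype_eq_comap, eventually_comap] at hmem
    filter_upwards [hmem] with x hx hxΩ using hx ⟨x, hxΩ⟩ rfl
  have hlog : (logNormSq fun z : Ω => e'.symm z (1 : ℂ)) =ᶠ[𝓝 (w : Fin m → ℂ)]
      fun x => (logNormSq fun z : Ω => e.symm z (1 : ℂ)) x + (ℓ x + conj (ℓ x)) := by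
    filter_upwards [hmem', hΩw, hslit] with x hx hxΩ hxs
    obtain ⟨h1, h2⟩ := hx hxΩ
    have hx0 : c x ≠ 0 := fun h => by simp [h] at hxs
    have hs : ‖e.symm (⟨x, hxΩ⟩ : Ω) (1 : ℂ)‖ ≠ 0 := norm_ne_zero_iff.mpr (frame_ne_zero e h1)
    have e1 := logNormSq_apply (fun z : Ω => e'.symm z (1 : ℂ)) ⟨x, hxΩ⟩
    have e2 := logNormSq_apply (fun z : Ω => e.symm z (1 : ℂ)) ⟨x, hxΩ⟩
    simp only at e1 e2
    rw [e1, e2, hcs _ h1 h2, norm_smul, Complex.add_conj]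
    simp only [ℓ, Complex.add_re, Complex.log_re, Complex.ofReal_re, norm_div]
    rw [← Complex.ofReal_add]
    congr 1
    rw [mul_pow, Real.log_mul (by simpa using hx0) (by simpa using hs), Real.log_pow,
      Real.log_div (by simpa using hx0) (by simpa using hcw)]
    push_cast
    ring
  have h3 : ContDiffAt ℝ 2 (logNormSq fun z : Ω => e.symm z (1 : ℂ)) w :=
    (contDiffAt_logNormSq_frame e hw).of_le ENat.LEInfty.out
  rw [curvatureMatrix, Matrix.of_apply, wirtinger_congr (wirtingerBar_eventuallyEq hlog j),
    wirtinger_wirtingerBar_add_re h3 hℓd]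

end Frame

/-! ### The main theorem -/

section Main

open Metric Filter Set
open scoped Topology ComplexConjugate

theorem IsInfinitelyDivisible.comp {X Y : Type*} [TopologicalSpace X] [TopologicalSpace Y]
    {K : X → X → ℂ} (hK : IsInfinitelyDivisible K) {g : Y → X} (hg : Continuous g) :
    IsInfinitelyDivisible fun z w => K (g z) (g w) := by
  obtain ⟨hpos, L, hLc, hLr, hLe, hLp⟩ := hK
  exact ⟨fun n y => hpos n (g ∘ y), fun z w => L (g z) (g w),
    hLc.comp ((hg.comp continuous_fst).prodMk (hg.comp continuous_snd)), fun x => hLr _,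
    fun x y => hLe _ _, fun t ht n y => hLp t ht n (g ∘ y)⟩

variable {m : ℕ} {Ω : Opens (Fin m → ℂ)}
  {E : Ω → Type*} [∀ w, NormedAddCommGroup (E w)] [∀ w, InnerProductSpace ℂ (E w)]
  [TopologicalSpace (TotalSpace ℂ E)] [FiberBundle ℂ E] [VectorBundle ℂ ℂ E]

/-- The isometry from a fibre of a line bundle onto the line spanned by a vector `x`, which sends
the frame vector to `a • x`. -/
theorem exists_fibre_isometry {H : Type*} [NormedAddCommGroup H] [InnerProductSpace ℂ H]
    (e : Trivialization ℂ (π ℂ E)) [MemTrivializationAtlas e] {w : Ω} (hw : w ∈ e.baseSet)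
    {x : H} (hx : x ≠ 0) {a : ℂ} (ha : a ≠ 0) (hnorm : ‖a‖ * ‖x‖ = ‖e.symm w (1 : ℂ)‖)
    {S : Submodule ℂ H} (hS : S = Submodule.span ℂ {x}) :
    ∃ T : E w ≃ₗᵢ[ℂ] S, ∀ v, (T v : H) = ((e ⟨w, v⟩).2 * a) • x := by
  subst hS
  set T₀ : E w ≃ₗ[ℂ] Submodule.span ℂ {x} :=
    ((e.linearEquivAt ℂ w hw).trans (LinearEquiv.smulOfNeZero ℂ ℂ a ha)).trans
      (LinearEquiv.toSpanNonzeroSingleton ℂ H x hx)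
  have hT₀ : ∀ v, (T₀ v : H) = ((e ⟨w, v⟩).2 * a) • x := fun v => by
    simp [T₀, mul_comm]
  refine ⟨⟨T₀, fun v => ?_⟩, hT₀⟩
  have h1 : ‖T₀ v‖ = ‖(T₀ v : H)‖ := rfl
  rw [h1, hT₀, norm_smul, norm_mul, mul_assoc, hnorm, ← norm_smul, frame_smul e hw]

/-- A section of a line bundle over `Ω₀` is holomorphic if and only if its coefficient in a
holomorphic frame, times a nowhere vanishing holomorphic vector, is holomorphic. -/
theorem mdifferentiableOn_section_iff_smul [ContMDiffVectorBundle 1 ℂ E 𝓘(ℂ, Fin m → ℂ)]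
    {H : Type*} [NormedAddCommGroup H] [InnerProductSpace ℂ H]
    (e : Trivialization ℂ (π ℂ E)) [MemTrivializationAtlas e] {Ω₀ : Opens Ω}
    (he : ∀ w : Ω₀, (w : Ω) ∈ e.baseSet) {a : (Fin m → ℂ) → ℂ} {γ : (Fin m → ℂ) → H} {y : H}
    (ha : ∀ w : Ω₀, DifferentiableAt ℂ a (w : Ω)) (ha0 : ∀ w : Ω₀, a (w : Ω) ≠ 0)
    (hγ : ∀ w : Ω₀, DifferentiableAt ℂ γ (w : Ω)) (hy : ∀ w : Ω₀, inner ℂ y (γ (w : Ω)) ≠ 0)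
    (U : Set Ω₀) (s : ∀ w : Ω₀, E w) :
    MDifferentiableOn 𝓘(ℂ, Fin m → ℂ) (𝓘(ℂ, Fin m → ℂ).prod 𝓘(ℂ, ℂ))
        (fun w : Ω₀ => (⟨w.1, s w⟩ : TotalSpace ℂ E)) U ↔
      MDifferentiableOn 𝓘(ℂ, Fin m → ℂ) 𝓘(ℂ, H)
        (fun w : Ω₀ => ((e ⟨w.1, s w⟩).2 * a (w : Ω)) • γ (w : Ω)) U := by
  refine forall₂_congr fun w hw => ?_
  have hval : MDifferentiableWithinAt 𝓘(ℂ, Fin m → ℂ) 𝓘(ℂ, Fin m → ℂ)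
      (fun w : Ω₀ => (w : Ω)) U w :=
    ((contMDiff_subtype_val (n := 1)).mdifferentiable one_ne_zero w).mdifferentiableWithinAt
  rw [e.mdifferentiableWithinAt_totalSpace_iff 𝓘(ℂ, Fin m → ℂ)
    (fun w : Ω₀ => (⟨w.1, s w⟩ : TotalSpace ℂ E)) ((e.mem_source).mpr (he w))]
  constructor
  · rintro ⟨-, hc⟩
    exact (hc.mul (mdifferentiableAt_comp_val_val (ha w)).mdifferentiableWithinAt).smul
      (mdifferentiableAt_comp_val_val (hγ w)).mdifferentiableWithinAt
  · intro hc
    refine ⟨hval, ?_⟩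
    -- Pairing the vector-valued section with `y` gives its coefficient times `k`, which is
    -- holomorphic without zeros and can be divided out.
    set k : (Fin m → ℂ) → ℂ := fun x => a x * inner ℂ y (γ x)
    have hk0 : ∀ w : Ω₀, k (w : Ω) ≠ 0 := fun w => mul_ne_zero (ha0 w) (hy w)
    have hkd : DifferentiableAt ℂ k (w : Ω) :=
      (ha w).mul ((innerSL ℂ y).differentiableAt.comp _ (hγ w))
    have h1 : MDifferentiableAt 𝓘(ℂ, Fin m → ℂ) 𝓘(ℂ, ℂ) (fun w : Ω₀ => (k (w : Ω))⁻¹) w :=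
      mdifferentiableAt_comp_val_val (g := fun x => (k x)⁻¹) (hkd.inv (hk0 w))
    have h2 : MDifferentiableWithinAt 𝓘(ℂ, Fin m → ℂ) 𝓘(ℂ, ℂ)
        (fun w : Ω₀ => inner ℂ y (((e ⟨w.1, s w⟩).2 * a (w : Ω)) • γ (w : Ω))) U w :=
      ((innerSL ℂ y).differentiableAt.mdifferentiableAt).comp_mdifferentiableWithinAt w hc
    have h3 : ∀ z : Ω₀, (e ⟨z.1, s z⟩).2
        = inner ℂ y (((e ⟨z.1, s z⟩).2 * a (z : Ω)) • γ (z : Ω)) * (k (z : Ω))⁻¹ := fun z => by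
      rw [inner_smul_right, mul_assoc, mul_assoc, ← mul_assoc (a (z : Ω)), mul_inv_cancel₀ (hk0 z),
        mul_one]
    exact (h2.mul h1.mdifferentiableWithinAt).congr (fun z _ => h3 z) (h3 w)

end Main

theorem mainTheorem8 {m : ℕ} (Ω : Opens (Fin m → ℂ))
    (hΩ : IsConnected (Ω : Set (Fin m → ℂ))) (hΩb : Bornology.IsBounded (Ω : Set (Fin m → ℂ)))
    (E : Ω → Type*) [∀ w, NormedAddCommGroup (E w)] [∀ w, InnerProductSpace ℂ (E w)]
    [TopologicalSpace (TotalSpace ℂ E)] [FiberBundle ℂ E] [VectorBundle ℂ ℂ E]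
    [ContMDiffVectorBundle ω ℂ E 𝓘(ℂ, Fin m → ℂ)] [IsHermitianBundle ℂ E]
    (hcurv : IsPositiveDefiniteFunction (fun w : Ω => - curvatureMatrix E w))
    (w₀ : Ω) :
    ∃ Ω₀ : Opens Ω, w₀ ∈ Ω₀ ∧ IsConnected (Ω₀ : Set Ω) ∧
      ∃ (H : Type) (_ : NormedAddCommGroup H) (_ : InnerProductSpace ℂ H) (_ : CompleteSpace H)
        (_ : SeparableSpace H) (γ : Ω₀ → H) (f : Ω₀ → Gr 1 H),
        MDifferentiable 𝓘(ℂ, Fin m → ℂ) 𝓘(ℂ, H) γ ∧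
        IsHolomorphicToGr (V := Fin m → ℂ) f ∧
        (∀ w, (f w).1 = Submodule.span ℂ {γ w}) ∧
        Nonempty (IsoPullbackTautological (V := Fin m → ℂ) ℂ E Ω₀ f) ∧
        IsInfinitelyDivisible (fun z w : Ω₀ => inner ℂ (γ w) (γ z)) := by
  classical
  set e := trivializationAt ℂ E w₀
  have hw₀ : w₀ ∈ e.baseSet := FiberBundle.mem_baseSet_trivializationAt' w₀
  have hopen : IsOpen ((↑) '' e.baseSet : Set (Fin m → ℂ)) :=
    Ω.isOpen.isOpenMap_subtype_val _ e.open_baseSet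
  obtain ⟨R, hR, hball⟩ := Metric.isOpen_iff.mp hopen w₀ ⟨w₀, hw₀, rfl⟩
  -- A ball inside the trivializing set is convex, as the primitives need, and it makes `Ω₀`
  -- connected.
  set B : Set (Fin m → ℂ) := Metric.ball w₀ R
  have hBΩ : ∀ x ∈ B, x ∈ Ω := fun x hx => by
    obtain ⟨z, _, rfl⟩ := hball hx
    exact z.2
  have hBe : ∀ z : Ω, (z : Fin m → ℂ) ∈ B → z ∈ e.baseSet := fun z hz => by
    obtain ⟨y, hy, hyz⟩ := hball hz
    rwa [← Subtype.ext hyz]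
  obtain ⟨G, hGd, hGdiag, hGpos⟩ := hcurv
  set h : (Fin m → ℂ) → ℂ := logNormSq fun z : Ω => e.symm z (1 : ℂ)
  obtain ⟨H, _, _, _, _, γ, φ, hγ, hφ, hnorm, hne, hdiv⟩ := exists_local_model (B := B) (h := h)
    (G := G) Metric.isOpen_ball (convex_ball _ _)
    (fun x hx => (contDiffAt_logNormSq_frame e (hBe ⟨x, hBΩ x hx⟩ hx)).contDiffWithinAt)
    (fun x hx => by
      have := logNormSq_apply (fun z : Ω => e.symm z (1 : ℂ)) ⟨x, hBΩ x hx⟩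
      simp only at this
      simp only [h, this, Complex.ofReal_im])
    (fun i j => (hGd i j).mono fun p hp => ⟨hBΩ _ hp.1, hBΩ _ hp.2⟩)
    (fun x hx i j => by
      have h1 := congrFun (congrFun (hGdiag ⟨x, hBΩ x hx⟩) i) j
      simp only at h1
      rw [h1, Matrix.neg_apply, curvatureMatrix_eq_frame e (hBe ⟨x, hBΩ x hx⟩ hx), neg_neg])
    (fun n x => hGpos n fun p => ⟨x p, hBΩ _ (x p).2⟩)
  have hγ0 : ∀ x ∈ B, γ x ≠ 0 := fun x hx h0 => hne x hx x hx (by simp [h0])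
  have hγd : ∀ x ∈ B, DifferentiableAt ℂ γ x := fun x hx =>
    hγ.differentiableAt (Metric.isOpen_ball.mem_nhds hx)
  have hφd : ∀ x ∈ B, DifferentiableAt ℂ φ x := fun x hx =>
    hφ.differentiableAt (Metric.isOpen_ball.mem_nhds hx)
  have hcont : Continuous fun z : Ω => (z : Fin m → ℂ) := continuous_subtype_val
  let Ω₀ : Opens Ω := ⟨(fun z : Ω => (z : Fin m → ℂ)) ⁻¹' B, Metric.isOpen_ball.preimage hcont⟩
  have hΩ₀ : ∀ w : Ω₀, ((w : Ω) : Fin m → ℂ) ∈ B := fun w => w.2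
  have hw₀B : (w₀ : Fin m → ℂ) ∈ B := Metric.mem_ball_self hR
  -- The vector `exp(φ) γ` has the norm of the frame, because `‖γ‖² = exp(h - 2 Re φ)` with `h` the
  -- log of the squared norm of the frame.
  have hfr : ∀ w : Ω₀, ‖Complex.exp (φ (w : Ω))‖ * ‖γ (w : Ω)‖ = ‖e.symm (w : Ω) (1 : ℂ)‖ := by
    intro w
    have h1 := hnorm _ (hΩ₀ w)
    have h2 : h (w : Ω) = _ := logNormSq_apply (fun z : Ω => e.symm z (1 : ℂ)) (w : Ω)
    have hs : 0 < ‖e.symm (w : Ω) (1 : ℂ)‖ := norm_pos_iff.mpr (frame_ne_zero e (hBe _ (hΩ₀ w)))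
    rw [Complex.add_conj, h2, ← Complex.ofReal_sub, ← Complex.ofReal_exp, Complex.ofReal_inj,
      Real.exp_sub, Real.exp_log (by positivity), two_mul, Real.exp_add, ← sq] at h1
    rw [Complex.norm_exp]
    rw [← sq_eq_sq₀ (mul_nonneg (Real.exp_pos _).le (norm_nonneg _)) hs.le]
    rw [mul_pow, h1]
    field_simp
  let f : Ω₀ → Gr 1 H := fun w =>
    ⟨Submodule.span ℂ {γ (w : Ω)}, finrank_span_singleton (hγ0 _ (hΩ₀ w))⟩
  have hγm : MDifferentiable 𝓘(ℂ, Fin m → ℂ) 𝓘(ℂ, H) fun w : Ω₀ => γ (w : Ω) := fun w =>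
    mdifferentiableAt_comp_val_val (hγd _ (hΩ₀ w))
  choose T hT using fun w : Ω₀ => exists_fibre_isometry e (hBe _ (hΩ₀ w)) (hγ0 _ (hΩ₀ w))
    (Complex.exp_ne_zero (φ (w : Ω))) (hfr w) (S := (f w).1) rfl
  have : ContMDiffVectorBundle 1 ℂ E 𝓘(ℂ, Fin m → ℂ) := inferInstance
  have hconn : IsConnected (Ω₀ : Set Ω) :=
    ((convex_ball (w₀ : Fin m → ℂ) R).isConnected ⟨w₀, hw₀B⟩).preimage_of_isOpenMap
      Subtype.val_injective Ω.isOpen.isOpenMap_subtype_val fun x hx => ⟨⟨x, hBΩ x hx⟩, rfl⟩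
  have hf : IsHolomorphicToGr (V := Fin m → ℂ) f := fun w =>
    ⟨Set.univ, isOpen_univ, trivial, fun _ w => γ (w : Ω), fun _ => hγm.mdifferentiableOn,
      fun w _ => by rw [Set.range_const]⟩
  have hiso : ∀ U : Set Ω₀, IsOpen U → ∀ s : (∀ w : Ω₀, E w.1),
      MDifferentiableOn 𝓘(ℂ, Fin m → ℂ) (𝓘(ℂ, Fin m → ℂ).prod 𝓘(ℂ, ℂ))
        (fun w : Ω₀ => (⟨w.1, s w⟩ : TotalSpace ℂ E)) U ↔
      MDifferentiableOn 𝓘(ℂ, Fin m → ℂ) 𝓘(ℂ, H) (fun w : Ω₀ => (T w (s w) : H)) U := by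
    intro U _ s
    simp only [hT]
    -- The test vector `y` is `γ w₀`, which is orthogonal to no `γ w` since the kernel has no zeros.
    exact mdifferentiableOn_section_iff_smul e (fun w => hBe _ (hΩ₀ w))
      (a := fun x => Complex.exp (φ x)) (fun w => (hφd _ (hΩ₀ w)).cexp)
      (fun w => Complex.exp_ne_zero _) (fun w => hγd _ (hΩ₀ w))
      (fun w => hne _ (hΩ₀ w) w₀ hw₀B) U s
  have hdiv' : IsInfinitelyDivisible fun z w : Ω₀ => inner ℂ (γ (w : Ω)) (γ (z : Ω)) :=
    hdiv.comp (g := fun w : Ω₀ => (⟨(w : Ω), hΩ₀ w⟩ : B))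
      ((hcont.comp continuous_subtype_val).subtype_mk _)
  exact ⟨Ω₀, hw₀B, hconn, H, inferInstance, inferInstance, inferInstance, inferInstance,
    fun w => γ (w : Ω), f, hγm, hf, fun w => rfl, ⟨{ toIsometry := T, holomorphic_iff := hiso }⟩,
    hdiv'⟩

end
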